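/- **Setting.** Let $J\in\mathbb R^{n\times n}$ be symmetric positive definite, $m\in\mathbb R^n$, and let $x_1,\dots,x_N$ be i.i.d. samples of the Gaussian vector with mean $m$ and covariance $\Sigma=J^{-1}$. Its graph has nodes $1,\dots,n$, with $k\ne l$ adjacent iff $J_{kl}\neq0$; $\mathcal N_i$ is the set of neighbors of $i$. Suppose that, for $0<\alpha<1$, $d_{\min}>0$, $a>0$ and $\Delta\in\mathbb N$, * $\big\|\,|I-D^{-1/2}JD^{-1/2}|\,\big\|_2\le\alpha$, where $D$ is the diagonal of $J$, $|\cdot|$ is the entrywise absolute value and $\|\cdot\|_2$ the spectral norm ($\alpha$ walk summability); * $d_{\min}\le J_{kk}\le d_{\max}$ for all $k$; * $a\le|J_{kl}|\le b$ whenever $k\neq l$ and $J_{kl}\ne0$; * every node has degree at most $\Delta$. **Algorithm.** Let $\hat\Sigma=\frac1N\sum_{t}(x_t-c)(x_t-c)^T$, where either $c=m$ (known mean) or $c=\frac1N\sum_t x_t$. For a set $S$ of nodes put $\hat\Sigma_{ij|S}=\hat\Sigma_{ij}-\hat\Sigma_{i,S}\hat\Sigma_{S,S}^{-1}\hat\Sigma_{S,j}$.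 Fix tuning parameters $\varepsilon$ and $\nu$, and let $$\tau=\frac{a}{d_{\max}\,(d_{\max}^2(1+\alpha)-a^2)}-\varepsilon,\qquad \tau^p=\nu a.$$ *Thresholding:* start from $S=\emptyset$; for at most $\Delta$ rounds, add to $S$ all $j\notin S\cup\{i\}$ with $|\hat\Sigma_{ij|S}|\ge\tau$; stop early when a round adds nothing. *Pruning:* from the resulting $S$ remove all nodes whose entry of the row vector $|\hat\Sigma_{i,S}\hat\Sigma_{S,S}^{-1}|$ is at most $\tau^p$, and return what is left. If a matrix $\hat\Sigma_{S,S}$ that has to be inverted is singular, the algorithm fails. **Theorem (structural consistency).** Let $\alpha,d_{\min},d_{\max},\Delta$ be as above, let $\kappa\in\mathbb R$ and $0<\delta<1$, and let $0<\nu<1/d_{\max}$. There are constants $C_3,C_4>0$, depending only on $\alpha,d_{\min},d_{\max},\Delta,\kappa,\delta,\nu$, such that for all $a,b,\varepsilon$ with $a>0$, $b\le\kappa a$ and $$\delta a\;\le\;\tau\;\le\;(1-\delta)\,\frac{a}{d_{\max}^2(1+\alpha)-a^2}$$ there is $C_5>0$ (which may depend also on $a,b,\varepsilon$, but not on $n$,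 $N$, $J$, $m$ or $i$) for which the following holds. For every $n$, every $J$ and $m$ as above and every node $i$, if $$N>C_3\,a^{-2}\log n,$$ then with probability at least $1-C_4\exp(-C_5N)$ thresholding followed by pruning does not fail and returns exactly $\mathcal N_i$. This holds for each of the two choices of $c$. (For given $a,b$, every $\varepsilon$ with $0<\tau<a/(d_{\max}^2(1+\alpha)-a^2)$ is covered by a suitable $\delta$; if $d_{\max}=1$ this is every $\varepsilon$ with $0<\varepsilon<\frac{a}{1+\alpha-a^2}$, provided $a^2<1+\alpha$.) -/

import Mathlib

open MeasureTheory ProbabilityTheory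

noncomputable section

namespace GGM

/-- The graph of a Gaussian graphical model with information matrix `J`: distinct nodes `k`, `l` are
adjacent iff `J k l ≠ 0` (`J` is symmetric in all uses, so the symmetrization is harmless). -/
def graph {n : ℕ} (J : Matrix (Fin n) (Fin n) ℝ) : SimpleGraph (Fin n) :=
  SimpleGraph.fromRel (fun k l => J k l ≠ 0)

/-- The partial correlation matrix `R = I - D^{-1/2} J D^{-1/2}`, with `D` the diagonal of `J`. -/
def partialCorr {n : ℕ} (J : Matrix (Fin n) (Fin n) ℝ) : Matrix (Fin n) (Fin n) ℝ :=
  1 - Matrix.diagonal (fun k => (√(J k k))⁻¹) * J * Matrix.diagonal (fun k => (√(J k k))⁻¹)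

/-- `α` walk summability: the spectral norm of the entrywise absolute value `|R|` is at most `α`. -/
def WalkSummable {n : ℕ} (α : ℝ) (J : Matrix (Fin n) (Fin n) ℝ) : Prop :=
  ‖Matrix.toEuclideanCLM (𝕜 := ℝ) ((partialCorr J).map (fun r => |r|))‖ ≤ α

/-- The standing assumptions on the information matrix of the model. -/
structure ModelAssumption {n : ℕ} (α dmin dmax a b : ℝ) (Δ : ℕ)
    (J : Matrix (Fin n) (Fin n) ℝ) : Prop where
  posDef : J.PosDef
  walkSummable : WalkSummable α J
  diag_mem : ∀ k, J k k ∈ Set.Icc dmin dmax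
  offDiag_mem : ∀ k l, k ≠ l → J k l ≠ 0 → |J k l| ∈ Set.Icc a b
  degree_le : ∀ k, ((graph J).neighborSet k).ncard ≤ Δ

/-- Empirical mean of the samples `x 0, …, x (N-1)`. -/
def sampleMean {n N : ℕ} (x : Fin N → EuclideanSpace ℝ (Fin n)) : EuclideanSpace ℝ (Fin n) :=
  (N : ℝ)⁻¹ • ∑ t, x t

/-- Empirical covariance of the samples `x`, centred at `c` (the mean of the model if it is known,
or the empirical mean). -/
def empCov {n N : ℕ} (c : EuclideanSpace ℝ (Fin n)) (x : Fin N → EuclideanSpace ℝ (Fin n)) :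
    Matrix (Fin n) (Fin n) ℝ :=
  Matrix.of fun k l => (N : ℝ)⁻¹ * ∑ t, (x t k - c k) * (x t l - c l)

/-- The submatrix `C_{S,S}`. -/
def block {n : ℕ} (C : Matrix (Fin n) (Fin n) ℝ) (S : Finset (Fin n)) : Matrix S S ℝ :=
  C.submatrix Subtype.val Subtype.val

/-- The row vector `C_{i,S} C_{S,S}⁻¹`. -/
def coeffRow {n : ℕ} (C : Matrix (Fin n) (Fin n) ℝ) (i : Fin n) (S : Finset (Fin n)) : S → ℝ :=
  Matrix.vecMul (fun k : S => C i k) (block C S)⁻¹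

/-- The conditional covariance `C_{ij|S} = C_{ij} - C_{i,S} C_{S,S}⁻¹ C_{S,j}`. -/
def condCov {n : ℕ} (C : Matrix (Fin n) (Fin n) ℝ) (i j : Fin n) (S : Finset (Fin n)) : ℝ :=
  C i j - coeffRow C i S ⬝ᵥ (fun k : S => C k j)

/-- One round of thresholding: add every `j ∉ {i} ∪ S` with `|C_{ij|S}| ≥ τ`. -/
def thresholdStep {n : ℕ} (C : Matrix (Fin n) (Fin n) ℝ) (i : Fin n) (τ : ℝ)
    (S : Finset (Fin n)) : Finset (Fin n) :=
  S ∪ Finset.univ.filter (fun j => j ∉ insert i S ∧ τ ≤ |condCov C i j S|)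

/-- The thresholding loop from the current set, with the given number of rounds left; it stops early
when a round adds nothing. The value `none` means failure: a matrix to be inverted is singular. -/
def thresholdLoop {n : ℕ} (C : Matrix (Fin n) (Fin n) ℝ) (i : Fin n) (τ : ℝ) :
    ℕ → Finset (Fin n) → Option (Finset (Fin n))
  | 0, S => some S
  | k + 1, S =>
    if (block C S).det = 0 then none
    else if thresholdStep C i τ S = S then some S
    else thresholdLoop C i τ k (thresholdStep C i τ S)

/-- The base value of the threshold of the thresholding algorithm, before `ε` is subtracted. -/
def baseThreshold (α dmax a : ℝ) : ℝ :=
  a * dmax⁻¹ * (dmax ^ 2 * (1 + α) - a ^ 2)⁻¹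

/-- The thresholding algorithm for node `i`: at most `Δ` rounds, starting from the empty set, with
threshold `τ = a dmax⁻¹ (dmax² (1 + α) - a²)⁻¹ - ε`. -/
def thresholding {n : ℕ} (C : Matrix (Fin n) (Fin n) ℝ) (i : Fin n) (Δ : ℕ) (α dmax a ε : ℝ) :
    Option (Finset (Fin n)) :=
  thresholdLoop C i (baseThreshold α dmax a - ε) Δ ∅

/-- The pruning algorithm: remove from `S` the nodes whose entry in `|C_{i,S} C_{S,S}⁻¹|` is at most
`τp = ν a`. The value `none` means failure: `C_{S,S}` is singular. -/
def pruning {n : ℕ} (C : Matrix (Fin n) (Fin n) ℝ) (i : Fin n) (a ν : ℝ) (S : Finset (Fin n)) :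
    Option (Finset (Fin n)) :=
  if (block C S).det = 0 then none
  else some (S \ (Finset.univ.filter (fun k : S => |coeffRow C i S k| ≤ ν * a)).map
    (Function.Embedding.subtype _))

/-- Thresholding followed by pruning. -/
def learnNeighborhood {n : ℕ} (C : Matrix (Fin n) (Fin n) ℝ) (i : Fin n) (Δ : ℕ)
    (α dmax a ε ν : ℝ) : Option (Finset (Fin n)) :=
  (thresholding C i Δ α dmax a ε).bind (pruning C i a ν)

/-- The output `out` is the actual neighborhood of `i` (and no failure occurred). -/
def IsExact {n : ℕ} (J : Matrix (Fin n) (Fin n) ℝ) (i : Fin n)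
    (out : Option (Finset (Fin n))) : Prop :=
  ∃ S : Finset (Fin n), out = some S ∧ (S : Set (Fin n)) = (graph J).neighborSet i

end GGM

end

/-! Fix `i` and a set `S` not containing `i`, and let `w j` be the exact conditional covariance
$\Sigma_{ij|S}$. Then `w` vanishes on `S`, while off `S` the vector `J w` is the unit vector at `i`.
Walk summability confines the quadratic form of `J` to $[l,L]$ with $l=(1-\alpha)d_{\min}$ and
$L=(1+\alpha)d_{\max}$. Everything about the exact model follows from these facts. Let `h` be the
column `i` of `J` outside $S\cup\{i\}$, and `v` the vector `w` with entry `i` erased.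

(1) If a neighbor is missing from `S`, some missing neighbor has $|w_k|\ge
a/(d_{\max}^2(1+\alpha)-a^2)$ (`exists_le_abs_of_offCol_ne_zero`), so an unfinished round makes
progress and Δ rounds suffice. (2) $l^4|v|^2\le|h|^2\le\Delta b^2$ (`eraseAt_dotProduct_le`). As
$b\le\kappa a$ and the threshold is at least $\delta a$, a round adds at most `M` nodes, with `M`
independent of `n` and `a`. All sets met have size at most `Δ * M`. (3) Once `S` contains the
neighbors, the regression coefficients are $-J_{ki}/J_{ii}$: at least $a/d_{\max}$ in size on
neighbors and zero elsewhere, so the pruning level $\nu a$ separates them.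

Because the sets have bounded size, an entrywise covariance error $\theta$ changes conditional
covariances and coefficients by $O(\theta)$, uniformly in `n` (`abs_vecMul_inv_sub_le`). Every
margin above is proportional to `a`, so accuracy $\eta a$ is enough, with $\eta$ independent of `a`.
Gaussian tail bounds and a union bound over $n^2$ entries give failure probability at most
$6n^2e^{-ca^2N}$; half of the exponent absorbs $n^2$ when $N>(4/c)a^{-2}\log n$. -/

noncomputable section

namespace GGM

/-! ### Coercive quadratic forms and their entrywise perturbations. -/

section QuadraticForm

variable {ι : Type*} [Fintype ι]

lemma dotProduct_self_nonneg' (x : ι → ℝ) : 0 ≤ x ⬝ᵥ x :=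
  Finset.sum_nonneg fun k _ => mul_self_nonneg (x k)

lemma sq_le_dotProduct_self (x : ι → ℝ) (k : ι) : x k ^ 2 ≤ x ⬝ᵥ x := by
  rw [sq]
  exact Finset.single_le_sum (f := fun k => x k * x k) (fun k _ => mul_self_nonneg (x k))
    (Finset.mem_univ k)

lemma dotProduct_mulVec_comm_of_isSymm {A : Matrix ι ι ℝ} (hA : A.IsSymm) (x y : ι → ℝ) :
    x ⬝ᵥ A.mulVec y = y ⬝ᵥ A.mulVec x := by
  rw [Matrix.dotProduct_mulVec, dotProduct_comm, ← Matrix.mulVec_transpose, hA.eq]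

lemma dotProduct_mulVec_add_smul {A : Matrix ι ι ℝ} (hA : A.IsSymm) (x y : ι → ℝ) (t : ℝ) :
    (x + t • y) ⬝ᵥ A.mulVec (x + t • y) =
      x ⬝ᵥ A.mulVec x + 2 * t * (y ⬝ᵥ A.mulVec x) + t ^ 2 * (y ⬝ᵥ A.mulVec y) := by
  simp only [Matrix.mulVec_add, Matrix.mulVec_smul, add_dotProduct, dotProduct_add,
    smul_dotProduct, dotProduct_smul, smul_eq_mul, dotProduct_mulVec_comm_of_isSymm hA x y]
  ring

/-- If the quadratic form of `A` is bounded above by `L`, that of `A⁻¹` is bounded below by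
`L⁻¹`. -/
lemma inv_mul_dotProduct_le_of_mul_eq_one [DecidableEq ι] {A B : Matrix ι ι ℝ} {L : ℝ} (hL : 0 < L)
    (hA : A.IsSymm) (hAB : A * B = 1) (hpos : ∀ x, 0 ≤ x ⬝ᵥ A.mulVec x)
    (hup : ∀ x, x ⬝ᵥ A.mulVec x ≤ L * (x ⬝ᵥ x)) (x : ι → ℝ) :
    L⁻¹ * (x ⬝ᵥ x) ≤ x ⬝ᵥ B.mulVec x := by
  have hx : A.mulVec (B.mulVec x) = x := by
    rw [Matrix.mulVec_mulVec, hAB, Matrix.one_mulVec]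
  -- Positivity at $Bx-x/L$ gives $0\le x\cdot Bx-\tfrac2L|x|^2+\tfrac1{L^2}\,x\cdot Ax$, and the
  -- last term is at most $|x|^2/L$.
  have h := hpos (B.mulVec x + (-L⁻¹) • x)
  rw [dotProduct_mulVec_add_smul hA, hx] at h
  have h2 := mul_le_mul_of_nonneg_left (hup x) (sq_nonneg (-L⁻¹))
  have h3 : (-L⁻¹) ^ 2 * (L * (x ⬝ᵥ x)) = L⁻¹ * (x ⬝ᵥ x) := by field_simp
  rw [dotProduct_comm x (B.mulVec x)]
  linarith

/-- If the quadratic form of `A` is bounded below by `l`, the entries of `A⁻¹` are at most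
`l⁻¹`. -/
lemma abs_apply_le_inv_of_mul_eq_one [DecidableEq ι] {A B : Matrix ι ι ℝ} {l : ℝ} (hl : 0 < l)
    (hAB : A * B = 1) (hlow : ∀ x, l * (x ⬝ᵥ x) ≤ x ⬝ᵥ A.mulVec x) (i j : ι) :
    |B i j| ≤ l⁻¹ := by
  set y := B.mulVec (Pi.single j 1) with hy
  have hyk : ∀ k, y k = B k j := fun k => by simp [hy]
  have hAy : A.mulVec y = Pi.single j 1 := by
    rw [hy, Matrix.mulVec_mulVec, hAB, Matrix.one_mulVec]
  -- For the column $y=Be_j$ this reads $l|y|^2\le y_j$. Hence $l\,y_j\le1$, and then $l^2y_i^2\le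
  -- l\,y_j\le1$.
  have h := hlow y
  rw [hAy, dotProduct_single, mul_one] at h
  have h1 := mul_le_mul_of_nonneg_left (sq_le_dotProduct_self y j) hl.le
  have h2 := mul_le_mul_of_nonneg_left (sq_le_dotProduct_self y i) hl.le
  have h3 : l * y j ≤ 1 := by
    by_contra! hc
    have : 0 < y j := by
      by_contra! h0
      nlinarith
    nlinarith
  rw [← hyk]
  apply abs_le_of_sq_le_sq _ (by positivity)
  rw [← mul_le_mul_iff_right₀ (mul_pos hl hl), show l * l * l⁻¹ ^ 2 = 1 by field_simp]
  nlinarith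

lemma sum_abs_sq_le (s : ℕ) (hs : Fintype.card ι ≤ s) (x : ι → ℝ) :
    (∑ k, |x k|) ^ 2 ≤ s * (x ⬝ᵥ x) := by
  have h := sq_sum_le_card_mul_sum_sq (s := Finset.univ) (f := fun k => |x k|)
  refine h.trans ?_
  have : ∑ k, |x k| ^ 2 = x ⬝ᵥ x := by simp [dotProduct, sq]
  rw [this]
  exact mul_le_mul_of_nonneg_right (by simpa using hs) (dotProduct_self_nonneg' x)

lemma abs_dotProduct_le_sum_abs_mul {x g : ι → ℝ} {G : ℝ} (hg : ∀ k, |g k| ≤ G) :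
    |x ⬝ᵥ g| ≤ (∑ k, |x k|) * G := by
  rw [dotProduct, Finset.sum_mul]
  refine (Finset.abs_sum_le_sum_abs _ _).trans (Finset.sum_le_sum fun k _ => ?_)
  rw [abs_mul]
  exact mul_le_mul_of_nonneg_left (hg k) (abs_nonneg _)

/-- A solution of `x A = g` is small in `ℓ¹` if `A` is coercive and `g` is small entrywise. -/
lemma sum_abs_le_of_vecMul_eq {A : Matrix ι ι ℝ} {μ G : ℝ} (hμ : 0 < μ) (hG : 0 ≤ G) {s : ℕ}
    (hs : Fintype.card ι ≤ s) (hA : ∀ x, μ * (x ⬝ᵥ x) ≤ x ⬝ᵥ A.mulVec x) {x g : ι → ℝ}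
    (hx : Matrix.vecMul x A = g) (hg : ∀ k, |g k| ≤ G) :
    ∑ k, |x k| ≤ s * G / μ := by
  have h1 := hA x
  rw [Matrix.dotProduct_mulVec, hx, dotProduct_comm g x] at h1
  have h2 := (le_abs_self _).trans (abs_dotProduct_le_sum_abs_mul (x := x) hg)
  have h3 := sum_abs_sq_le s hs x
  rw [le_div_iff₀ hμ]
  set X := ∑ k, |x k|
  have hX : 0 ≤ X := Finset.sum_nonneg fun k _ => abs_nonneg _
  rcases hX.eq_or_lt with h0 | h0
  · rw [← h0]; simp; positivity
  · have : X * (X * μ) ≤ X * (s * G) := by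
      have h4 : (s : ℝ) * (μ * (x ⬝ᵥ x)) ≤ s * (X * G) :=
        mul_le_mul_of_nonneg_left (h1.trans h2) (Nat.cast_nonneg _)
      nlinarith
    exact le_of_mul_le_mul_left this h0

lemma det_ne_zero_of_coercive [DecidableEq ι] {A : Matrix ι ι ℝ} {μ : ℝ} (hμ : 0 < μ)
    (hA : ∀ x, μ * (x ⬝ᵥ x) ≤ x ⬝ᵥ A.mulVec x) : A.det ≠ 0 := by
  intro h
  obtain ⟨x, hx, hAx⟩ := Matrix.exists_mulVec_eq_zero_iff.mpr h
  have h1 := hA x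
  rw [hAx, dotProduct_zero] at h1
  exact hx (dotProduct_self_eq_zero.mp
    (le_antisymm (by nlinarith [dotProduct_self_nonneg' x]) (dotProduct_self_nonneg' x)))

/-- Coercivity is stable under entrywise perturbations. -/
lemma coercive_of_abs_sub_le {A A' : Matrix ι ι ℝ} {μ θ : ℝ} {s : ℕ}
    (hs : Fintype.card ι ≤ s) (hθ : 0 ≤ θ) (hsθ : s * θ ≤ μ / 2)
    (hA : ∀ x, μ * (x ⬝ᵥ x) ≤ x ⬝ᵥ A.mulVec x) (hAA' : ∀ k l, |A' k l - A k l| ≤ θ) (x : ι → ℝ) :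
    μ / 2 * (x ⬝ᵥ x) ≤ x ⬝ᵥ A'.mulVec x := by
  have h1 : |x ⬝ᵥ (A' - A).mulVec x| ≤ (∑ k, |x k|) * ((∑ k, |x k|) * θ) := by
    apply abs_dotProduct_le_sum_abs_mul
    intro k
    rw [Matrix.mulVec, dotProduct_comm]
    exact abs_dotProduct_le_sum_abs_mul fun l => hAA' k l
  have h2 := sum_abs_sq_le s hs x
  have h3 : (∑ k, |x k|) * ((∑ k, |x k|) * θ) ≤ μ / 2 * (x ⬝ᵥ x) :=
    calc _ = (∑ k, |x k|) ^ 2 * θ := by ring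
      _ ≤ (s * (x ⬝ᵥ x)) * θ := mul_le_mul_of_nonneg_right h2 hθ
      _ = (s * θ) * (x ⬝ᵥ x) := by ring
      _ ≤ _ := mul_le_mul_of_nonneg_right hsθ (dotProduct_self_nonneg' x)
  rw [Matrix.sub_mulVec, dotProduct_sub] at h1
  have h4 := (abs_le.mp (h1.trans h3)).1
  have h5 := hA x
  linarith

/-- Perturbation bounds for regression coefficients and residual covariances. -/
lemma abs_vecMul_inv_sub_le [DecidableEq ι] {A A' : Matrix ι ι ℝ} {μ B θ : ℝ} {s : ℕ} (hμ : 0 < μ)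
    (hs : Fintype.card ι ≤ s) (hB : 0 ≤ B) (hθ : 0 ≤ θ) (hsθ : s * θ ≤ μ / 2)
    (hA : ∀ x, μ * (x ⬝ᵥ x) ≤ x ⬝ᵥ A.mulVec x) (hAA' : ∀ k l, |A' k l - A k l| ≤ θ)
    {g g' : ι → ℝ} (hg : ∀ k, |g k| ≤ B) (hgg' : ∀ k, |g' k - g k| ≤ θ) :
    ∑ k, |Matrix.vecMul g' A'⁻¹ k - Matrix.vecMul g A⁻¹ k| ≤
      2 * s / μ * (1 + s * B / μ) * θ ∧
    ∀ h h' : ι → ℝ, (∀ k, |h k| ≤ B) → (∀ k, |h' k - h k| ≤ θ) →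
      |Matrix.vecMul g' A'⁻¹ ⬝ᵥ h' - Matrix.vecMul g A⁻¹ ⬝ᵥ h| ≤
        (2 * s / μ * (1 + s * B / μ) * (B + θ) + s * B / μ) * θ := by
  have hA' := coercive_of_abs_sub_le hs hθ hsθ hA hAA'
  have hd := isUnit_iff_ne_zero.mpr (det_ne_zero_of_coercive hμ hA)
  have hd' := isUnit_iff_ne_zero.mpr (det_ne_zero_of_coercive (half_pos hμ) hA')
  set β := Matrix.vecMul g A⁻¹ with hβ
  set β' := Matrix.vecMul g' A'⁻¹ with hβ'
  have e1 : Matrix.vecMul β A = g := by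
    rw [hβ, Matrix.vecMul_vecMul, Matrix.nonsing_inv_mul _ hd, Matrix.vecMul_one]
  have e2 : Matrix.vecMul β' A' = g' := by
    rw [hβ', Matrix.vecMul_vecMul, Matrix.nonsing_inv_mul _ hd', Matrix.vecMul_one]
  have b1 := sum_abs_le_of_vecMul_eq hμ hB hs hA e1 hg
  -- The difference of the two solutions solves a system with the perturbed, still coercive matrix
  -- and a right-hand side of order `θ`, so the `ℓ¹` bound applies to it.
  have e3 : Matrix.vecMul (β' - β) A' = (g' - g) - Matrix.vecMul β (A' - A) := by
    rw [Matrix.sub_vecMul, Matrix.vecMul_sub, e1, e2]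
    abel
  have key : ∑ k, |(β' - β) k| ≤ 2 * s / μ * (1 + s * B / μ) * θ := by
    have h0 : ∀ k, |((g' - g) - Matrix.vecMul β (A' - A)) k| ≤ (1 + s * B / μ) * θ := by
      intro k
      have h1 : |Matrix.vecMul β (A' - A) k| ≤ (∑ k, |β k|) * θ :=
        abs_dotProduct_le_sum_abs_mul fun l => hAA' l k
      have h2 := mul_le_mul_of_nonneg_right b1 hθ
      have h3 := hgg' k
      rw [Pi.sub_apply, Pi.sub_apply]
      have h4 := abs_sub (g' k - g k) (Matrix.vecMul β (A' - A) k)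
      linarith
    have h1 := sum_abs_le_of_vecMul_eq (half_pos hμ) (by positivity) hs hA' e3 h0
    refine h1.trans (le_of_eq ?_)
    field_simp
  refine ⟨key, fun h h' hh hhh' => ?_⟩
  have e4 : β' ⬝ᵥ h' - β ⬝ᵥ h = (β' - β) ⬝ᵥ h' + β ⬝ᵥ (h' - h) := by
    rw [sub_dotProduct, dotProduct_sub]; ring
  have hh'' : ∀ k, |h' k| ≤ B + θ := fun k => by
    have := abs_sub_abs_le_abs_sub (h' k) (h k)
    linarith [hh k, hhh' k]
  have h5 := abs_dotProduct_le_sum_abs_mul (x := β' - β) hh''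
  have h6 : |β ⬝ᵥ (h' - h)| ≤ (∑ k, |β k|) * θ := abs_dotProduct_le_sum_abs_mul hhh'
  have h7 := mul_le_mul_of_nonneg_right key (add_nonneg hB hθ)
  have h8 := mul_le_mul_of_nonneg_right b1 hθ
  rw [e4]
  refine (abs_add_le _ _).trans ?_
  linarith

end QuadraticForm

/-! ### Spectral bounds on the information matrix from walk summability. -/

section Model

variable {n : ℕ}

/-- Taking absolute values inside the double sum replaces `R` by `|R|` and `x` by `|x|`, which has
the same Euclidean norm. -/
lemma abs_dotProduct_partialCorr_le {α : ℝ} {J : Matrix (Fin n) (Fin n) ℝ}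
    (h : WalkSummable α J) (x : Fin n → ℝ) :
    |x ⬝ᵥ (partialCorr J).mulVec x| ≤ α * (x ⬝ᵥ x) := by
  set R := partialCorr J
  let y : Fin n → ℝ := fun k => |x k|
  have h1 : |x ⬝ᵥ R.mulVec x| ≤ y ⬝ᵥ (R.map (fun r => |r|)).mulVec y := by
    simp only [dotProduct, Matrix.mulVec, y, Matrix.map_apply]
    refine (Finset.abs_sum_le_sum_abs _ _).trans (Finset.sum_le_sum fun k _ => ?_)
    rw [abs_mul]
    refine mul_le_mul_of_nonneg_left ?_ (abs_nonneg _)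
    refine (Finset.abs_sum_le_sum_abs _ _).trans (Finset.sum_le_sum fun l _ => ?_)
    rw [abs_mul]
  refine h1.trans ?_
  have h2 := real_inner_le_norm (WithLp.toLp 2 y)
    (Matrix.toEuclideanCLM (𝕜 := ℝ) (R.map (fun r => |r|)) (WithLp.toLp 2 y))
  rw [Matrix.inner_toEuclideanCLM] at h2
  refine h2.trans ?_
  have h3 := (Matrix.toEuclideanCLM (𝕜 := ℝ) (R.map (fun r => |r|))).le_of_opNorm_le h
    (WithLp.toLp 2 y)
  have h4 : ‖WithLp.toLp 2 y‖ ^ 2 = x ⬝ᵥ x := by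
    rw [EuclideanSpace.real_norm_sq_eq]
    simp [y, dotProduct, sq]
  rw [← h4]
  calc _ ≤ ‖WithLp.toLp 2 y‖ * (α * ‖WithLp.toLp 2 y‖) :=
        mul_le_mul_of_nonneg_left h3 (norm_nonneg _)
    _ = _ := by ring

/-- This is $J=D^{1/2}(I-R)D^{1/2}$ as an identity of quadratic forms. -/
lemma dotProduct_mulVec_eq_sub_partialCorr {J : Matrix (Fin n) (Fin n) ℝ} (hJ : ∀ k, 0 < J k k)
    (x : Fin n → ℝ) :
    x ⬝ᵥ J.mulVec x = (fun k => √(J k k) * x k) ⬝ᵥ (fun k => √(J k k) * x k) -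
      (fun k => √(J k k) * x k) ⬝ᵥ (partialCorr J).mulVec (fun k => √(J k k) * x k) := by
  have hs : ∀ k, √(J k k) ≠ 0 := fun k => (Real.sqrt_pos.mpr (hJ k)).ne'
  rw [partialCorr, Matrix.sub_mulVec, Matrix.one_mulVec, dotProduct_sub, sub_sub_cancel]
  simp only [dotProduct, Matrix.mulVec, Matrix.mul_diagonal, Matrix.diagonal_mul]
  refine Finset.sum_congr rfl fun k _ => ?_
  rw [Finset.mul_sum, Finset.mul_sum]
  refine Finset.sum_congr rfl fun l _ => ?_
  have h1 := hs k
  have h2 := hs l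
  field_simp

variable {α dmin dmax a b : ℝ} {Δ : ℕ} {J : Matrix (Fin n) (Fin n) ℝ}

lemma ModelAssumption.isSymm (h : ModelAssumption α dmin dmax a b Δ J) : J.IsSymm := by
  have := h.posDef.isHermitian
  rwa [Matrix.IsHermitian, Matrix.conjTranspose_eq_transpose_of_trivial] at this

lemma ModelAssumption.coercive (h : ModelAssumption α dmin dmax a b Δ J) (hd : 0 < dmin)
    (hα1 : α < 1) (x : Fin n → ℝ) :
    (1 - α) * dmin * (x ⬝ᵥ x) ≤ x ⬝ᵥ J.mulVec x := by
  have hJ : ∀ k, 0 < J k k := fun k => hd.trans_le (h.diag_mem k).1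
  rw [dotProduct_mulVec_eq_sub_partialCorr hJ]
  set y : Fin n → ℝ := fun k => √(J k k) * x k
  have h1 := (abs_le.mp (abs_dotProduct_partialCorr_le h.walkSummable y)).2
  have h2 : dmin * (x ⬝ᵥ x) ≤ y ⬝ᵥ y := by
    simp only [dotProduct, y, Finset.mul_sum]
    refine Finset.sum_le_sum fun k _ => ?_
    rw [mul_mul_mul_comm, Real.mul_self_sqrt (hJ k).le]
    exact mul_le_mul_of_nonneg_right (h.diag_mem k).1 (mul_self_nonneg _)
  nlinarith

lemma ModelAssumption.dotProduct_mulVec_le (h : ModelAssumption α dmin dmax a b Δ J)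
    (hd : 0 < dmin) (hα : 0 < α) (x : Fin n → ℝ) :
    x ⬝ᵥ J.mulVec x ≤ (1 + α) * dmax * (x ⬝ᵥ x) := by
  have hJ : ∀ k, 0 < J k k := fun k => hd.trans_le (h.diag_mem k).1
  rw [dotProduct_mulVec_eq_sub_partialCorr hJ]
  set y : Fin n → ℝ := fun k => √(J k k) * x k
  have h1 := (abs_le.mp (abs_dotProduct_partialCorr_le h.walkSummable y)).1
  have h2 : y ⬝ᵥ y ≤ dmax * (x ⬝ᵥ x) := by
    simp only [dotProduct, y, Finset.mul_sum]
    refine Finset.sum_le_sum fun k _ => ?_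
    rw [mul_mul_mul_comm, Real.mul_self_sqrt (hJ k).le]
    exact mul_le_mul_of_nonneg_right (h.diag_mem k).2 (mul_self_nonneg _)
  nlinarith

end Model

/-! ### Exact conditional covariances as solutions of a linear system for `J`. -/

section ConditionalCovariance

variable {n : ℕ} {J : Matrix (Fin n) (Fin n) ℝ} {i : Fin n} {S : Finset (Fin n)}

/-- The witness is `x` extended by zero. It lets blocks inherit coercivity. -/
lemma dotProduct_block_mulVec (C : Matrix (Fin n) (Fin n) ℝ) (S : Finset (Fin n)) (x : S → ℝ) :
    ∃ y : Fin n → ℝ, y ⬝ᵥ y = x ⬝ᵥ x ∧ y ⬝ᵥ C.mulVec y = x ⬝ᵥ (block C S).mulVec x := by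
  classical
  let y : Fin n → ℝ := fun k => if h : k ∈ S then x ⟨k, h⟩ else 0
  have hy : ∀ k : S, y k = x k := fun k => by simp [y]
  have hy0 : ∀ k, k ∉ S → y k = 0 := fun k hk => by simp [y, hk]
  have hsum : ∀ f : Fin n → ℝ, ∑ k, y k * f k = ∑ k : S, x k * f k := fun f => by
    rw [← Finset.sum_subset (Finset.subset_univ S) (fun k _ hk => by simp [hy0 k hk]),
      ← Finset.sum_coe_sort S]
    simp [hy]
  refine ⟨y, ?_, ?_⟩
  · simp only [dotProduct]
    rw [hsum]
    simp [hy]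
  · simp only [dotProduct, Matrix.mulVec]
    rw [hsum]
    refine Finset.sum_congr rfl fun k _ => ?_
    congr 1
    simp_rw [mul_comm (C _ _)]
    rw [hsum]
    simp [block, mul_comm]

lemma block_coercive {C : Matrix (Fin n) (Fin n) ℝ} {μ : ℝ}
    (hC : ∀ x, μ * (x ⬝ᵥ x) ≤ x ⬝ᵥ C.mulVec x) (S : Finset (Fin n)) (x : S → ℝ) :
    μ * (x ⬝ᵥ x) ≤ x ⬝ᵥ (block C S).mulVec x := by
  obtain ⟨y, h1, h2⟩ := dotProduct_block_mulVec C S x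
  rw [← h1, ← h2]
  exact hC y

lemma condCov_eq_zero_of_mem {C : Matrix (Fin n) (Fin n) ℝ} (hd : (block C S).det ≠ 0) (i : Fin n)
    {j : Fin n} (hj : j ∈ S) : condCov C i j S = 0 := by
  have e1 : Matrix.vecMul (coeffRow C i S) (block C S) = fun k : S => C i k := by
    rw [coeffRow, Matrix.vecMul_vecMul, Matrix.nonsing_inv_mul _ (isUnit_iff_ne_zero.mpr hd),
      Matrix.vecMul_one]
  have := congrFun e1 ⟨j, hj⟩
  rw [condCov, ← this]
  simp [Matrix.vecMul, block, dotProduct]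

/-- Multiplying the conditional covariances given `S` by the information matrix `J = C⁻¹`. -/
lemma mulVec_condCov {C : Matrix (Fin n) (Fin n) ℝ} (hJC : C * J = 1) (hJ : J.IsSymm)
    (i l : Fin n) :
    J.mulVec (fun j => condCov C i j S) l =
      (if l = i then 1 else 0) - if h : l ∈ S then coeffRow C i S ⟨l, h⟩ else 0 := by
  classical
  have hCJ : ∀ k, ∑ j, J l j * C k j = if l = k then 1 else 0 := fun k => by
    have := congrFun (congrFun hJC k) l
    rw [Matrix.mul_apply, Matrix.one_apply] at this
    simp_rw [eq_comm (a := l), ← this]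
    refine Finset.sum_congr rfl fun j _ => ?_
    rw [mul_comm, hJ.apply]
  simp only [Matrix.mulVec, dotProduct, condCov, mul_sub, Finset.sum_sub_distrib, hCJ]
  congr 1
  simp_rw [Finset.mul_sum]
  rw [Finset.sum_comm]
  have : ∀ k : S, ∑ j, J l j * (coeffRow C i S k * C k j) =
      coeffRow C i S k * if l = k then 1 else 0 := fun k => by
    rw [← hCJ, Finset.mul_sum]
    exact Finset.sum_congr rfl fun j _ => by ring
  simp_rw [this]
  split_ifs with h
  · rw [Finset.sum_eq_single ⟨l, h⟩]
    · simp
    · intro k _ hk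
      rw [if_neg, mul_zero]
      rintro rfl
      exact hk rfl
    · simp
  · refine Finset.sum_eq_zero fun k _ => ?_
    rw [if_neg, mul_zero]
    rintro rfl
    exact h k.2

variable {w : Fin n → ℝ} {l L : ℝ}

/-- From here on `w` stands for $j\mapsto\Sigma_{ij|S}$, known only through `hw0` and `hw`. Since
`w` vanishes on `S` and `J w` vanishes off $S\cup\{i\}$, only the term at `i` survives. -/
lemma dotProduct_mulVec_eq_apply (hi : i ∉ S) (hw0 : ∀ j ∈ S, w j = 0)
    (hw : ∀ k ∉ S, J.mulVec w k = if k = i then 1 else 0) : w ⬝ᵥ J.mulVec w = w i := by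
  rw [dotProduct, Finset.sum_eq_single i]
  · simp [hw i hi]
  · intro k _ hk
    by_cases hkS : k ∈ S
    · simp [hw0 k hkS]
    · simp [hw k hkS, hk]
  · simp

/-- Coercivity gives $l\,w_i^2\le l|w|^2\le w_i$, and $w_i=0$ would force $w=0$, against $(Jw)_i=1$.
-/
lemma apply_pos_and_mul_le_one (hi : i ∉ S) (hl : 0 < l)
    (hlow : ∀ x, l * (x ⬝ᵥ x) ≤ x ⬝ᵥ J.mulVec x) (hw0 : ∀ j ∈ S, w j = 0)
    (hw : ∀ k ∉ S, J.mulVec w k = if k = i then 1 else 0) : 0 < w i ∧ l * w i ≤ 1 := by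
  have h1 := hlow w
  rw [dotProduct_mulVec_eq_apply hi hw0 hw] at h1
  have h2 := mul_le_mul_of_nonneg_left (sq_le_dotProduct_self w i) hl.le
  have hne : w i ≠ 0 := by
    intro h0
    have h3 : w ⬝ᵥ w = 0 := le_antisymm (by nlinarith) (dotProduct_self_nonneg' w)
    have := hw i hi
    rw [dotProduct_self_eq_zero.mp h3] at this
    simp at this
  have hpos : 0 < w i := lt_of_le_of_ne
    ((mul_nonneg hl.le (dotProduct_self_nonneg' w)).trans h1) hne.symm
  exact ⟨hpos, by nlinarith⟩

/-- The column `i` of `J`, restricted to the complement of `insert i S`. -/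
def offCol (J : Matrix (Fin n) (Fin n) ℝ) (i : Fin n) (S : Finset (Fin n)) : Fin n → ℝ :=
  fun k => if k ∈ insert i S then 0 else J k i

/-- The vector `w` with the entry at `i` replaced by `0`. -/
def eraseAt (w : Fin n → ℝ) (i : Fin n) : Fin n → ℝ := w + (-w i) • Pi.single i 1

lemma eraseAt_self (w : Fin n → ℝ) (i : Fin n) : eraseAt w i i = 0 := by simp [eraseAt]

lemma eraseAt_of_ne (w : Fin n → ℝ) {i k : Fin n} (h : k ≠ i) : eraseAt w i k = w k := by
  simp [eraseAt, h]

lemma mulVec_eraseAt (J : Matrix (Fin n) (Fin n) ℝ) (w : Fin n → ℝ) (i k : Fin n) :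
    J.mulVec (eraseAt w i) k = J.mulVec w k - w i * J k i := by
  rw [eraseAt, Matrix.mulVec_add, Matrix.mulVec_smul]
  simp
  ring

/-- On the complement `T` of $S\cup\{i\}$ the system for `w` reads $J_{TT}v=-w_ih$, and its row `i`
reads $J_{ii}w_i+h\cdot v=1$. This lemma and the next two express these equations without forming
$J_{TT}$. -/
lemma offCol_dotProduct_eraseAt (hJ : J.IsSymm) (hi : i ∉ S) (hw0 : ∀ j ∈ S, w j = 0)
    (hw : ∀ k ∉ S, J.mulVec w k = if k = i then 1 else 0) :
    offCol J i S ⬝ᵥ eraseAt w i = 1 - J i i * w i := by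
  have h1 : offCol J i S ⬝ᵥ eraseAt w i = J.mulVec (eraseAt w i) i := by
    simp only [dotProduct, Matrix.mulVec]
    refine Finset.sum_congr rfl fun k _ => ?_
    by_cases hki : k = i
    · simp [hki, eraseAt_self]
    by_cases hkS : k ∈ S
    · simp [eraseAt_of_ne w hki, hw0 k hkS]
    · simp [offCol, hki, hkS, hJ.apply]
  rw [h1, mulVec_eraseAt, hw i hi]
  simp [mul_comm]

lemma offCol_dotProduct_mulVec_eraseAt
    (hw : ∀ k ∉ S, J.mulVec w k = if k = i then 1 else 0) :
    offCol J i S ⬝ᵥ J.mulVec (eraseAt w i) = -w i * (offCol J i S ⬝ᵥ offCol J i S) := by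
  simp only [dotProduct, Finset.mul_sum]
  refine Finset.sum_congr rfl fun k _ => ?_
  by_cases hk : k ∈ insert i S
  · simp [offCol, hk]
  · rw [mulVec_eraseAt]
    have hk' := hk
    rw [Finset.mem_insert, not_or] at hk
    rw [hw k hk.2]
    simp only [offCol, if_neg hk', if_neg hk.1]
    ring

lemma eraseAt_dotProduct_mulVec (hJ : J.IsSymm) (hi : i ∉ S) (hw0 : ∀ j ∈ S, w j = 0)
    (hw : ∀ k ∉ S, J.mulVec w k = if k = i then 1 else 0) :
    eraseAt w i ⬝ᵥ J.mulVec (eraseAt w i) = w i * (J i i * w i - 1) := by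
  rw [eraseAt, dotProduct_mulVec_add_smul hJ, dotProduct_mulVec_eq_apply hi hw0 hw,
    single_dotProduct, single_dotProduct, hw i hi]
  simp
  ring

/-- In block terms this is $h^TJ_{TT}^{-1}h\ge|h|^2/L$. Positivity of the form at $v+(w_i/L)h$
proves it without an inverse. -/
lemma mul_offCol_le (hJ : J.IsSymm) (hi : i ∉ S) (hl : 0 < l) (hL : 0 < L)
    (hlow : ∀ x, l * (x ⬝ᵥ x) ≤ x ⬝ᵥ J.mulVec x) (hup : ∀ x, x ⬝ᵥ J.mulVec x ≤ L * (x ⬝ᵥ x))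
    (hw0 : ∀ j ∈ S, w j = 0) (hw : ∀ k ∉ S, J.mulVec w k = if k = i then 1 else 0) :
    w i * (offCol J i S ⬝ᵥ offCol J i S) ≤ L * (J i i * w i - 1) := by
  have hpos := (apply_pos_and_mul_le_one hi hl hlow hw0 hw).1
  set v := eraseAt w i with hv
  set h := offCol J i S with hh
  have h1 := hlow (v + (w i / L) • h)
  have h2 : 0 ≤ (v + (w i / L) • h) ⬝ᵥ J.mulVec (v + (w i / L) • h) :=
    (mul_nonneg hl.le (dotProduct_self_nonneg' _)).trans h1
  rw [dotProduct_mulVec_add_smul hJ, hv, hh, offCol_dotProduct_mulVec_eraseAt hw,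
    eraseAt_dotProduct_mulVec hJ hi hw0 hw, ← hh] at h2
  have h3 := mul_le_mul_of_nonneg_left (hup h) (sq_nonneg (w i / L))
  have h4 : (w i / L) ^ 2 * (L * (h ⬝ᵥ h)) = w i / L * (w i * (h ⬝ᵥ h)) := by field_simp
  have h5 : 0 ≤ w i / L * (L * (J i i * w i - 1) - w i * (h ⬝ᵥ h)) := by
    have h6 : w i / L * (L * (J i i * w i - 1)) = w i * (J i i * w i - 1) := by field_simp
    rw [mul_sub, h6]
    linarith
  have h6 := (mul_nonneg_iff_of_pos_left (div_pos hpos hL)).mp h5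
  linarith

/-- Some neighbor of `i` outside `S` has a large conditional covariance with `i`. -/
lemma exists_le_abs_of_offCol_ne_zero {a d : ℝ} (hJ : J.IsSymm) (hi : i ∉ S) (hl : 0 < l)
    (hL : 0 < L) (ha : 0 < a) (hd : J i i ≤ d) (had : 0 < L * d - a ^ 2)
    (hlow : ∀ x, l * (x ⬝ᵥ x) ≤ x ⬝ᵥ J.mulVec x) (hup : ∀ x, x ⬝ᵥ J.mulVec x ≤ L * (x ⬝ᵥ x))
    (hw0 : ∀ j ∈ S, w j = 0) (hw : ∀ k ∉ S, J.mulVec w k = if k = i then 1 else 0)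
    (hne : ∃ k, offCol J i S k ≠ 0) (hle : ∀ k, offCol J i S k ≠ 0 → a ≤ |offCol J i S k|) :
    ∃ k, offCol J i S k ≠ 0 ∧ a / (L * d - a ^ 2) ≤ |w k| := by
  by_contra! hcon
  have hpos := (apply_pos_and_mul_le_one hi hl hlow hw0 hw).1
  have hQ := mul_offCol_le hJ hi hl hL hlow hup hw0 hw
  have hD := offCol_dotProduct_eraseAt hJ hi hw0 hw
  set h := offCol J i S with hh
  set T := a / (L * d - a ^ 2) with hT
  have hT0 : 0 < T := div_pos ha had
  have hi0 : h i = 0 := by simp [hh, offCol]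
  obtain ⟨k₀, hk₀⟩ := hne
  have hH : a ^ 2 ≤ h ⬝ᵥ h := by
    refine le_trans ?_ (sq_le_dotProduct_self h k₀)
    rw [← sq_abs (h k₀)]
    have := hle k₀ hk₀
    gcongr
  -- If all $|w_k|<T$ on the support of `h`, then $J_{ii}w_i-1=-h\cdot v<T\sum|h_k|\le T|h|^2/a$,
  -- the last step because nonzero entries of `h` are at least `a` in size.
  have hlt : a * (J i i * w i - 1) < T * (h ⬝ᵥ h) := by
    have e : J i i * w i - 1 = ∑ k, -(h k * eraseAt w i k) := by
      rw [Finset.sum_neg_distrib]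
      have : ∑ k, h k * eraseAt w i k = 1 - J i i * w i := hD
      linarith
    rw [e, dotProduct, Finset.mul_sum, Finset.mul_sum]
    have hterm : ∀ k, h k ≠ 0 → a * -(h k * eraseAt w i k) < T * (h k * h k) := by
      intro k hk
      have hki : k ≠ i := by rintro rfl; exact hk hi0
      rw [eraseAt_of_ne w hki]
      have h1 := hcon k hk
      have h2 := hle k hk
      have h3 : -(h k * w k) ≤ |h k| * |w k| := by rw [← abs_mul]; exact neg_le_abs _
      have h4 : |h k| * |w k| < |h k| * T := mul_lt_mul_of_pos_left h1 (abs_pos.mpr hk)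
      have h5 : a * (|h k| * T) ≤ |h k| * (|h k| * T) :=
        mul_le_mul_of_nonneg_right h2 (by positivity)
      have h6 : |h k| * (|h k| * T) = T * (h k * h k) := by
        rw [← mul_assoc, abs_mul_abs_self]; ring
      have h7 := mul_lt_mul_of_pos_left (h3.trans_lt h4) ha
      linarith
    refine Finset.sum_lt_sum (fun k _ => ?_) ⟨k₀, Finset.mem_univ _, hterm k₀ hk₀⟩
    by_cases hk : h k = 0
    · simp [hk]
    · exact (hterm k hk).le
  have hHpos : 0 < h ⬝ᵥ h := (by positivity : (0 : ℝ) < a ^ 2).trans_le hH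
  have h1 : w i * a < T * L := by
    have h2 : a * (w i * (h ⬝ᵥ h)) < L * (T * (h ⬝ᵥ h)) :=
      calc _ ≤ a * (L * (J i i * w i - 1)) := mul_le_mul_of_nonneg_left hQ ha.le
        _ = L * (a * (J i i * w i - 1)) := by ring
        _ < _ := mul_lt_mul_of_pos_left hlt hL
    have h3 : (w i * a) * (h ⬝ᵥ h) < (T * L) * (h ⬝ᵥ h) := by linarith
    exact lt_of_mul_lt_mul_right h3 hHpos.le
  -- Equivalently $L\le w_i(Ld-a^2)$. With $w_ia<TL$ and $T(Ld-a^2)=a$ this yields $aL\le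
  -- w_ia(Ld-a^2)<aL$, a contradiction.
  have h2 : w i * a ^ 2 ≤ L * (d * w i - 1) := by
    have h3 := mul_le_mul_of_nonneg_left hH hpos.le
    have h4 : L * (J i i * w i - 1) ≤ L * (d * w i - 1) := by gcongr
    linarith
  have h5 : T * (L * d - a ^ 2) = a := div_mul_cancel₀ _ had.ne'
  have h6 := mul_lt_mul_of_pos_right h1 had
  have h7 : T * L * (L * d - a ^ 2) = a * L := by rw [mul_right_comm, h5]
  nlinarith

/-- The conditional covariances with `i` are square summable, with a bound of the order of the
off-diagonal entries of `J`. -/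
lemma eraseAt_dotProduct_le (hJ : J.IsSymm) (hi : i ∉ S) (hl : 0 < l)
    (hlow : ∀ x, l * (x ⬝ᵥ x) ≤ x ⬝ᵥ J.mulVec x)
    (hw0 : ∀ j ∈ S, w j = 0) (hw : ∀ k ∉ S, J.mulVec w k = if k = i then 1 else 0) :
    l ^ 4 * (eraseAt w i ⬝ᵥ eraseAt w i) ≤ offCol J i S ⬝ᵥ offCol J i S := by
  obtain ⟨hpos, hle⟩ := apply_pos_and_mul_le_one hi hl hlow hw0 hw
  have h1 := hlow (eraseAt w i)
  rw [eraseAt_dotProduct_mulVec hJ hi hw0 hw] at h1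
  have hD := offCol_dotProduct_eraseAt hJ hi hw0 hw
  have hCS : (offCol J i S ⬝ᵥ eraseAt w i) ^ 2 ≤
      (offCol J i S ⬝ᵥ offCol J i S) * (eraseAt w i ⬝ᵥ eraseAt w i) := by
    have := Finset.sum_mul_sq_le_sq_mul_sq Finset.univ (offCol J i S) (eraseAt w i)
    simpa [dotProduct, sq] using this
  set X := eraseAt w i ⬝ᵥ eraseAt w i with hX
  set H := offCol J i S ⬝ᵥ offCol J i S
  have hX0 : 0 ≤ X := dotProduct_self_nonneg' _
  have hH0 : 0 ≤ H := dotProduct_self_nonneg' _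
  rw [hD] at hCS
  rcases hX0.eq_or_lt with h0 | h0
  · rw [← h0]; simpa using hH0
  -- Since $v\cdot Jv=-w_i\,h\cdot v$, Cauchy–Schwarz gives $l|v|^2\le w_i|h||v|$; then $w_i\le1/l$
  -- is used.
  have h2 : (l * X) ^ 2 ≤ (w i * (J i i * w i - 1)) ^ 2 := by gcongr
  have h3 : (l * X) ^ 2 ≤ w i ^ 2 * (H * X) := by
    have := mul_le_mul_of_nonneg_left hCS (sq_nonneg (w i))
    nlinarith
  have h4 : (l ^ 2 * X) * X ≤ (w i ^ 2 * H) * X := by linarith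
  have h5 := le_of_mul_le_mul_right h4 h0
  have h6 : (l * w i) ^ 2 ≤ 1 := pow_le_one₀ (by positivity) hle
  calc l ^ 4 * X = l ^ 2 * (l ^ 2 * X) := by ring
    _ ≤ l ^ 2 * (w i ^ 2 * H) := by gcongr
    _ = (l * w i) ^ 2 * H := by ring
    _ ≤ 1 * H := by gcongr
    _ = H := one_mul H

/-- If `S` contains the neighbors of `i`, then `i` is conditionally uncorrelated with the rest. -/
lemma eq_single_of_forall_eq_zero (hi : i ∉ S) (hl : 0 < l) (hii : J i i ≠ 0)
    (hlow : ∀ x, l * (x ⬝ᵥ x) ≤ x ⬝ᵥ J.mulVec x)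
    (hw0 : ∀ j ∈ S, w j = 0) (hw : ∀ k ∉ S, J.mulVec w k = if k = i then 1 else 0)
    (hN : ∀ k, k ≠ i → k ∉ S → J k i = 0) : w = Pi.single i (J i i)⁻¹ := by
  set u := w - Pi.single i (J i i)⁻¹ with hu
  -- The vector `u` vanishes on `S` and `J u` vanishes off `S`.
  have h0 : u ⬝ᵥ J.mulVec u = 0 := by
    refine Finset.sum_eq_zero fun k _ => ?_
    by_cases hkS : k ∈ S
    · have : k ≠ i := by rintro rfl; exact hi hkS
      simp [hu, hw0 k hkS, this]
    · have : J.mulVec u k = 0 := by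
        rw [hu, Matrix.mulVec_sub, Pi.sub_apply, hw k hkS]
        by_cases hki : k = i
        · simp [hki, hii]
        · simp [hki, hN k hki hkS]
      rw [this, mul_zero]
  have h1 := hlow u
  rw [h0] at h1
  have h2 : u = 0 := dotProduct_self_eq_zero.mp
    (le_antisymm (by nlinarith [dotProduct_self_nonneg' u]) (dotProduct_self_nonneg' u))
  exact sub_eq_zero.mp h2

end ConditionalCovariance

/-! ### Combinatorics of the thresholding loop and of pruning. -/

section Algorithm

variable {n : ℕ} {C : Matrix (Fin n) (Fin n) ℝ} {i : Fin n}

/-- If every round with a missing target node adds one of the target nodes and at most `M` nodes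
altogether, the thresholding loop succeeds and covers the target set. -/
lemma thresholdLoop_covers {τ : ℝ} {Nb : Finset (Fin n)} {M s : ℕ} (hiN : i ∉ Nb)
    (hdet : ∀ S : Finset (Fin n), i ∉ S → S.card ≤ s → (block C S).det ≠ 0)
    (hnew : ∀ S : Finset (Fin n), i ∉ S → S.card ≤ s →
      (Finset.univ.filter (fun j => j ∉ insert i S ∧ τ ≤ |condCov C i j S|)).card ≤ M)
    (hmiss : ∀ S : Finset (Fin n), i ∉ S → S.card ≤ s → ¬ Nb ⊆ S →
      ∃ j ∈ Nb, j ∉ S ∧ τ ≤ |condCov C i j S|)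
    (k : ℕ) (S : Finset (Fin n)) (hi : i ∉ S) (hcard : S.card + k * M ≤ s)
    (hN : (Nb \ S).card ≤ k) :
    ∃ S', thresholdLoop C i τ k S = some S' ∧ i ∉ S' ∧ Nb ⊆ S' ∧ S'.card ≤ s := by
  induction k generalizing S with
  | zero =>
    refine ⟨S, rfl, hi, ?_, by omega⟩
    rw [← Finset.sdiff_eq_empty_iff_subset, ← Finset.card_eq_zero]
    omega
  | succ k ih =>
    have hs : S.card ≤ s := (Nat.le_add_right _ _).trans hcard
    have hadd := hnew S hi hs
    have hstep : thresholdStep C i τ S = S ∪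
      Finset.univ.filter (fun j => j ∉ insert i S ∧ τ ≤ |condCov C i j S|) := rfl
    rw [thresholdLoop, if_neg (hdet S hi hs)]
    split_ifs with hstable
    · refine ⟨S, rfl, hi, ?_, hs⟩
      by_contra hNS
      obtain ⟨j, hjN, hjS, hj⟩ := hmiss S hi hs hNS
      refine hjS ?_
      rw [← hstable, hstep]
      have hji : j ≠ i := by rintro rfl; exact hiN hjN
      simp [hji, hjS, hj]
    · refine ih _ ?_ ?_ ?_
      · rw [hstep]; simp [hi]
      · have := Finset.card_union_le S
          (Finset.univ.filter (fun j => j ∉ insert i S ∧ τ ≤ |condCov C i j S|))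
        rw [hstep]
        have e : (k + 1) * M = k * M + M := by ring
        omega
      -- After the target is covered, rounds may still add other nodes; this is harmless, as their
      -- number is controlled by `hcard`.
      · by_cases hNS : Nb ⊆ S
        · have : Nb \ thresholdStep C i τ S = ∅ := by
            rw [Finset.sdiff_eq_empty_iff_subset, hstep]
            exact hNS.trans Finset.subset_union_left
          rw [this]; simp
        · obtain ⟨j, hjN, hjS, hj⟩ := hmiss S hi hs hNS
          have hji : j ≠ i := by rintro rfl; exact hiN hjN
          have hlt : (Nb \ thresholdStep C i τ S).card < (Nb \ S).card := by
            apply Finset.card_lt_card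
            rw [Finset.ssubset_iff_of_subset
              (Finset.sdiff_subset_sdiff le_rfl (by rw [hstep]; exact Finset.subset_union_left))]
            refine ⟨j, by simp [hjN, hjS], ?_⟩
            rw [hstep]
            simp [hjS, hji, hj]
          omega

lemma pruning_eq_some {S Nb : Finset (Fin n)} {a ν : ℝ} (hdet : (block C S).det ≠ 0) (hNS : Nb ⊆ S)
    (h : ∀ k : S, (k : Fin n) ∈ Nb ↔ ν * a < |coeffRow C i S k|) :
    pruning C i a ν S = some Nb := by
  rw [pruning, if_neg hdet]
  congr 1
  ext k
  simp only [Finset.mem_sdiff, Finset.mem_map, Finset.mem_filter, Finset.mem_univ, true_and,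
    Function.Embedding.subtype_apply]
  constructor
  · rintro ⟨hk, hk'⟩
    by_contra hc
    exact hk' ⟨⟨k, hk⟩, not_lt.mp fun h' => hc ((h ⟨k, hk⟩).mpr h'), rfl⟩
  · intro hk
    refine ⟨hNS hk, ?_⟩
    rintro ⟨k', hk', rfl⟩
    exact absurd ((h k').mp hk) (not_lt.mpr hk')

end Algorithm

/-! ### Correctness of the algorithm for an accurate covariance estimate. -/

section Deterministic

variable {n : ℕ} {α dmin dmax a b : ℝ} {Δ : ℕ} {J : Matrix (Fin n) (Fin n) ℝ}

/-- The neighbors of `i`, as a finset. -/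
def neighbors (J : Matrix (Fin n) (Fin n) ℝ) (i : Fin n) : Finset (Fin n) :=
  Finset.univ.filter fun k => k ≠ i ∧ J k i ≠ 0

lemma coe_neighbors (hJ : J.IsSymm) (i : Fin n) :
    (neighbors J i : Set (Fin n)) = (graph J).neighborSet i := by
  ext k
  simp [neighbors, graph, hJ.apply k i, eq_comm]

lemma offCol_ne_zero_iff {i k : Fin n} {S : Finset (Fin n)} :
    offCol J i S k ≠ 0 ↔ k ∈ neighbors J i ∧ k ∉ S := by
  simp only [offCol, neighbors, Finset.mem_insert, Finset.mem_filter, Finset.mem_univ, true_and]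
  split_ifs with h
  · simp only [ne_eq, not_true_eq_false, false_iff]
    tauto
  · tauto

lemma offCol_eq_of_ne_zero {i k : Fin n} {S : Finset (Fin n)} (h : offCol J i S k ≠ 0) :
    offCol J i S k = J k i := by
  unfold offCol at h ⊢
  split_ifs at h ⊢ with h'
  · exact absurd rfl h
  · rfl

lemma ModelAssumption.card_neighbors_le (h : ModelAssumption α dmin dmax a b Δ J) (i : Fin n) :
    (neighbors J i).card ≤ Δ := by
  have := h.degree_le i
  rwa [← coe_neighbors h.isSymm, Set.ncard_coe_finset] at this

lemma ModelAssumption.offCol_mem (h : ModelAssumption α dmin dmax a b Δ J) {i k : Fin n}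
    {S : Finset (Fin n)} (hk : offCol J i S k ≠ 0) : |offCol J i S k| ∈ Set.Icc a b := by
  have hk' := (offCol_ne_zero_iff.mp hk).1
  rw [offCol_eq_of_ne_zero hk]
  simp only [neighbors, Finset.mem_filter, Finset.mem_univ, true_and] at hk'
  exact h.offDiag_mem k i hk'.1 hk'.2

lemma ModelAssumption.offCol_dotProduct_le (h : ModelAssumption α dmin dmax a b Δ J)
    (i : Fin n) (S : Finset (Fin n)) :
    offCol J i S ⬝ᵥ offCol J i S ≤ Δ * b ^ 2 := by
  have h1 : offCol J i S ⬝ᵥ offCol J i S = ∑ k ∈ neighbors J i, offCol J i S k ^ 2 := by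
    rw [dotProduct, Finset.sum_subset (Finset.subset_univ (neighbors J i))]
    · exact Finset.sum_congr rfl fun k _ => (sq _).symm
    · intro k _ hk
      have h0 : offCol J i S k = 0 := by
        by_contra hne
        exact hk (offCol_ne_zero_iff.mp hne).1
      simp [h0]
  rw [h1]
  calc _ ≤ ∑ k ∈ neighbors J i, b ^ 2 := Finset.sum_le_sum fun k _ => by
        by_cases hk : offCol J i S k = 0
        · rw [hk]; simp; positivity
        · rw [← sq_abs]
          exact pow_le_pow_left₀ (abs_nonneg _) (h.offCol_mem hk).2 2
    _ = (neighbors J i).card * b ^ 2 := by simp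
    _ ≤ _ := by
        gcongr
        exact_mod_cast h.card_neighbors_le i

/-- Markov's inequality for counting measure; it bounds the number of nodes added in a round. -/
lemma card_mul_sq_le {v : Fin n → ℝ} {c : ℝ} (hc : 0 ≤ c) (F : Finset (Fin n))
    (hF : ∀ j ∈ F, c ≤ |v j|) : F.card * c ^ 2 ≤ v ⬝ᵥ v := by
  calc (F.card : ℝ) * c ^ 2 = ∑ j ∈ F, c ^ 2 := by simp
    _ ≤ ∑ j ∈ F, v j * v j := Finset.sum_le_sum fun j hj => by
        rw [← abs_mul_abs_self, ← sq]
        exact pow_le_pow_left₀ hc (hF j hj) 2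
    _ ≤ _ := Finset.sum_le_sum_of_subset_of_nonneg (Finset.subset_univ _)
        fun j _ _ => mul_self_nonneg _

/-- The factor relating entrywise errors of the covariance to errors of regression coefficients. -/
def coeffErr (μ B : ℝ) (s : ℕ) : ℝ := 2 * s / μ * (1 + s * B / μ)

/-- The factor relating entrywise errors of the covariance to errors of conditional covariances. -/
def condErr (μ B : ℝ) (s : ℕ) : ℝ := 1 + (coeffErr μ B s * (B + 1) + s * B / μ)

lemma coeffErr_nonneg {μ B : ℝ} (hμ : 0 < μ) (hB : 0 ≤ B) (s : ℕ) : 0 ≤ coeffErr μ B s := by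
  unfold coeffErr; positivity

lemma coeffErr_le_condErr {μ B : ℝ} (hμ : 0 < μ) (hB : 0 ≤ B) (s : ℕ) :
    coeffErr μ B s ≤ condErr μ B s := by
  have h1 := coeffErr_nonneg hμ hB s
  have h2 : 0 ≤ s * B / μ := by positivity
  have h3 := mul_nonneg h1 hB
  unfold condErr
  linarith

/-- If the covariance is estimated entrywise up to a small multiple of `a`, thresholding followed by
pruning recovers the neighborhood. -/
theorem isExact_learnNeighborhood {κ δ ν ε η θ : ℝ} {M : ℕ} (hα : 0 < α) (hα1 : α < 1)
    (hdmin : 0 < dmin) (hδ : 0 < δ) (ha : 0 < a) (hb : b ≤ κ * a)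
    (hτ : δ * a ≤ baseThreshold α dmax a - ε)
    (hτ' : baseThreshold α dmax a - ε ≤ (1 - δ) * (a / (dmax ^ 2 * (1 + α) - a ^ 2)))
    (had : 0 < dmax ^ 2 * (1 + α) - a ^ 2)
    (hM : Δ * κ ^ 2 ≤ ((1 - α) * dmin) ^ 4 * (δ / 2) ^ 2 * M)
    (hη₁ : η ≤ δ / 2) (hη₂ : η ≤ δ / (2 * dmax ^ 2)) (hη₃ : η ≤ ν) (hη₄ : η < dmax⁻¹ - ν)
    (h : ModelAssumption α dmin dmax a b Δ J) (i : Fin n)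
    (hθ : 0 ≤ θ) (hθ1 : θ ≤ 1)
    (hsθ : (Δ * M : ℕ) * θ ≤ ((1 + α) * dmax)⁻¹ / 2)
    (hKθ : condErr ((1 + α) * dmax)⁻¹ ((1 - α) * dmin)⁻¹ (Δ * M) * θ ≤ η * a)
    {C : Matrix (Fin n) (Fin n) ℝ} (hC : ∀ k l, |C k l - J⁻¹ k l| ≤ θ) :
    IsExact J i (learnNeighborhood C i Δ α dmax a ε ν) := by
  set l := (1 - α) * dmin with hl_def
  set L := (1 + α) * dmax with hL_def
  set s := Δ * M
  set τ := baseThreshold α dmax a - ε with hτ_def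
  have hl : 0 < l := mul_pos (by linarith) hdmin
  have hdm : 0 < dmax := hdmin.trans_le ((h.diag_mem i).1.trans (h.diag_mem i).2)
  have hL : 0 < L := by positivity
  have hJ := h.isSymm
  have hlow := h.coercive hdmin hα1
  have hup := h.dotProduct_mulVec_le hdmin hα
  have hJu : IsUnit J.det := isUnit_iff_ne_zero.mpr (det_ne_zero_of_coercive hl hlow)
  have hJC := Matrix.mul_nonsing_inv J hJu
  have hCJ := Matrix.nonsing_inv_mul J hJu
  have hB := abs_apply_le_inv_of_mul_eq_one hl hJC hlow
  have hμ := inv_mul_dotProduct_le_of_mul_eq_one hL hJ hJC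
    (fun x => (mul_nonneg hl.le (dotProduct_self_nonneg' x)).trans (hlow x)) hup
  have hμ0 : 0 < L⁻¹ := inv_pos.mpr hL
  have hB0 : 0 ≤ l⁻¹ := (inv_pos.mpr hl).le
  have hblock : ∀ S : Finset (Fin n), (block J⁻¹ S).det ≠ 0 := fun S =>
    det_ne_zero_of_coercive hμ0 (block_coercive hμ S)
  have hdet : ∀ S : Finset (Fin n), S.card ≤ s → (block C S).det ≠ 0 := fun S hS =>
    det_ne_zero_of_coercive (half_pos hμ0) (coercive_of_abs_sub_le (by simpa using hS) hθ hsθ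
      (block_coercive hμ S) fun k l => hC k l)
  have hpert := fun (S : Finset (Fin n)) (hS : S.card ≤ s) =>
    abs_vecMul_inv_sub_le (A := block J⁻¹ S) (A' := block C S) (B := l⁻¹) (θ := θ) hμ0
      (by simpa using hS) hB0 hθ hsθ (block_coercive hμ S) (fun k l => hC k l)
      (g := fun k : S => J⁻¹ i k) (g' := fun k : S => C i k) (fun k => hB _ _) (fun k => hC _ _)
  have hcoeff : ∀ S : Finset (Fin n), S.card ≤ s → ∀ k : S,
      |coeffRow C i S k - coeffRow J⁻¹ i S k| ≤ η * a := by
    intro S hS k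
    have h1 := Finset.single_le_sum
      (f := fun k : S => |coeffRow C i S k - coeffRow J⁻¹ i S k|)
      (fun k _ => abs_nonneg _) (Finset.mem_univ k)
    refine h1.trans ((hpert S hS).1.trans (le_trans ?_ hKθ))
    exact mul_le_mul_of_nonneg_right (coeffErr_le_condErr hμ0 hB0 s) hθ
  have hcond : ∀ S : Finset (Fin n), S.card ≤ s → ∀ j,
      |condCov C i j S - condCov J⁻¹ i j S| ≤ η * a := by
    intro S hS j
    have h1 := (hpert S hS).2 (fun k : S => J⁻¹ k j) (fun k : S => C k j) (fun k => hB _ _)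
      (fun k => hC _ _)
    have h2 := hC i j
    refine le_trans ?_ hKθ
    have e : condCov C i j S - condCov J⁻¹ i j S = (C i j - J⁻¹ i j) -
        (coeffRow C i S ⬝ᵥ (fun k : S => C k j) - coeffRow J⁻¹ i S ⬝ᵥ fun k : S => J⁻¹ k j) := by
      simp only [condCov]; ring
    rw [e]
    refine (abs_sub _ _).trans ((add_le_add h2 h1).trans ?_)
    have h3 : coeffErr L⁻¹ l⁻¹ s * (l⁻¹ + θ) ≤ coeffErr L⁻¹ l⁻¹ s * (l⁻¹ + 1) :=
      mul_le_mul_of_nonneg_left (by linarith) (coeffErr_nonneg hμ0 hB0 s)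
    have h4 : (coeffErr L⁻¹ l⁻¹ s * (l⁻¹ + θ) + s * l⁻¹ / L⁻¹) * θ ≤
        (coeffErr L⁻¹ l⁻¹ s * (l⁻¹ + 1) + s * l⁻¹ / L⁻¹) * θ :=
      mul_le_mul_of_nonneg_right (by linarith) hθ
    have h5 : condErr L⁻¹ l⁻¹ s * θ =
        θ + (coeffErr L⁻¹ l⁻¹ s * (l⁻¹ + 1) + s * l⁻¹ / L⁻¹) * θ := by
      rw [condErr, add_mul, one_mul]
    rw [h5]
    exact add_le_add le_rfl h4
  have hw0 : ∀ S : Finset (Fin n), ∀ j ∈ S, condCov J⁻¹ i j S = 0 := fun S j hj =>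
    condCov_eq_zero_of_mem (hblock S) i hj
  have hw : ∀ S : Finset (Fin n), ∀ k ∉ S,
      J.mulVec (fun j => condCov J⁻¹ i j S) k = if k = i then 1 else 0 := fun S k hk => by
    rw [mulVec_condCov hCJ hJ, dif_neg hk, sub_zero]
  have hiN : i ∉ neighbors J i := by simp [neighbors]
  -- The estimation error fits into the gap between the guaranteed conditional covariance and `τ`,
  -- which is at most $(1-\delta)$ times it.
  have hT : η * a ≤ δ * (a / (dmax ^ 2 * (1 + α) - a ^ 2)) := by
    have h1 : a / (2 * dmax ^ 2) ≤ a / (dmax ^ 2 * (1 + α) - a ^ 2) := by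
      apply div_le_div_of_nonneg_left ha.le had
      nlinarith [sq_nonneg a, sq_nonneg dmax]
    calc η * a ≤ δ / (2 * dmax ^ 2) * a := mul_le_mul_of_nonneg_right hη₂ ha.le
      _ = δ * (a / (2 * dmax ^ 2)) := by ring
      _ ≤ _ := mul_le_mul_of_nonneg_left h1 hδ.le
  have hnew : ∀ S : Finset (Fin n), i ∉ S → S.card ≤ s →
      (Finset.univ.filter (fun j => j ∉ insert i S ∧ τ ≤ |condCov C i j S|)).card ≤ M := by
    intro S hi hS
    set F := Finset.univ.filter (fun j => j ∉ insert i S ∧ τ ≤ |condCov C i j S|) with hF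
    -- An added node has estimated value at least $\tau\ge\delta a$; the error takes away at most
    -- half of that.
    have h1 : ∀ j ∈ F, δ / 2 * a ≤ |eraseAt (fun j => condCov J⁻¹ i j S) i j| := by
      intro j hj
      simp only [hF, Finset.mem_filter, Finset.mem_univ, true_and, Finset.mem_insert,
        not_or] at hj
      rw [eraseAt_of_ne _ hj.1.1]
      have h2 := hcond S hS j
      have h3 := abs_sub_abs_le_abs_sub (condCov C i j S) (condCov J⁻¹ i j S)
      have h4 : η * a ≤ δ / 2 * a := mul_le_mul_of_nonneg_right hη₁ ha.le
      linarith [hj.2]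
    have h2 := card_mul_sq_le (by positivity) F h1
    have h3 := eraseAt_dotProduct_le hJ hi hl hlow (hw0 S) (hw S)
    have h4 := h.offCol_dotProduct_le i S
    have h5 : (F.card : ℝ) * (l ^ 4 * (δ / 2) ^ 2 * a ^ 2) ≤ M * (l ^ 4 * (δ / 2) ^ 2 * a ^ 2) := by
      -- The sign of `b` is not prescribed, and $b\le\kappa a$ can be squared only when $b\ge0$. For
      -- $b<0$ no off-diagonal entry is nonzero, so $h=0$.
      by_cases hb0 : 0 ≤ b
      · calc _ = l ^ 4 * (F.card * (δ / 2 * a) ^ 2) := by ring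
          _ ≤ l ^ 4 * _ := mul_le_mul_of_nonneg_left h2 (by positivity)
          _ ≤ Δ * b ^ 2 := h3.trans h4
          _ ≤ Δ * (κ * a) ^ 2 := by gcongr
          _ = Δ * κ ^ 2 * a ^ 2 := by ring
          _ ≤ (l ^ 4 * (δ / 2) ^ 2 * M) * a ^ 2 := by gcongr
          _ = _ := by ring
      · have h6 : offCol J i S = 0 := by
          funext k
          by_contra hk
          have h7 := h.offCol_mem hk
          exact hb0 ((abs_nonneg _).trans h7.2)
        calc _ = l ^ 4 * (F.card * (δ / 2 * a) ^ 2) := by ring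
          _ ≤ l ^ 4 * _ := mul_le_mul_of_nonneg_left h2 (by positivity)
          _ ≤ 0 := by rw [h6] at h3; simpa using h3
          _ ≤ _ := by positivity
    exact_mod_cast le_of_mul_le_mul_right h5 (by positivity)
  have hmiss : ∀ S : Finset (Fin n), i ∉ S → S.card ≤ s → ¬ neighbors J i ⊆ S →
      ∃ j ∈ neighbors J i, j ∉ S ∧ τ ≤ |condCov C i j S| := by
    intro S hi hS hNS
    obtain ⟨k₀, hk₀, hk₀S⟩ := Finset.not_subset.mp hNS
    have eL : L * dmax - a ^ 2 = dmax ^ 2 * (1 + α) - a ^ 2 := by rw [hL_def]; ring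
    obtain ⟨k, hk, hTk⟩ := exists_le_abs_of_offCol_ne_zero hJ hi hl hL ha (h.diag_mem i).2
      (by rw [eL]; exact had) hlow hup (hw0 S) (hw S)
      ⟨k₀, offCol_ne_zero_iff.mpr ⟨hk₀, hk₀S⟩⟩ (fun k hk => (h.offCol_mem hk).1)
    rw [eL] at hTk
    obtain ⟨hkN, hkS⟩ := offCol_ne_zero_iff.mp hk
    refine ⟨k, hkN, hkS, ?_⟩
    have h2 := hcond S hS k
    rw [abs_sub_comm] at h2
    have h3 := abs_sub_abs_le_abs_sub (condCov J⁻¹ i k S) (condCov C i k S)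
    linarith
  obtain ⟨S, hS, hi, hNS, hScard⟩ := thresholdLoop_covers hiN (fun S _ => hdet S) hnew hmiss Δ ∅
    (by simp) (by simp [s]) (by simpa using h.card_neighbors_le i)
  refine ⟨neighbors J i, ?_, coe_neighbors hJ i⟩
  rw [learnNeighborhood, thresholding, ← hτ_def, hS, Option.bind_some]
  refine pruning_eq_some (hdet S hScard) hNS fun k => ?_
  have hii : 0 < J i i := hdmin.trans_le (h.diag_mem i).1
  have hwS := eq_single_of_forall_eq_zero hi hl hii.ne' hlow (hw0 S) (hw S) fun k hki hkS => by
    by_contra hne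
    exact hkS (hNS (by simp [neighbors, hki, hne]))
  -- Row `k` of $Jw=e_i-\beta$ (with `β` extended by zero), evaluated at $w=e_i/J_{ii}$.
  have hβ : coeffRow J⁻¹ i S k = -(J k i * (J i i)⁻¹) := by
    have h1 := mulVec_condCov (S := S) hCJ hJ i k
    have hki : (k : Fin n) ≠ i := fun e => hi (e ▸ k.2)
    rw [hwS, dif_pos k.2, if_neg hki] at h1
    simp only [Matrix.mulVec_single, Pi.smul_apply, Matrix.col_apply, MulOpposite.smul_eq_mul_unop,
      MulOpposite.unop_op] at h1
    linarith
  have h2 := hcoeff S hScard k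
  constructor
  · intro hk
    have hk' := offCol_ne_zero_iff (S := ∅).mpr ⟨hk, by simp⟩
    have h3 := (h.offCol_mem hk').1
    rw [offCol_eq_of_ne_zero hk'] at h3
    have h4 : a * dmax⁻¹ ≤ |coeffRow J⁻¹ i S k| := by
      rw [hβ, abs_neg, abs_mul, abs_of_pos (inv_pos.mpr hii)]
      have h5 := (h.diag_mem i).2
      gcongr
    rw [abs_sub_comm] at h2
    have h5 := abs_sub_abs_le_abs_sub (coeffRow J⁻¹ i S k) (coeffRow C i S k)
    have h6 : η * a < (dmax⁻¹ - ν) * a := mul_lt_mul_of_pos_right hη₄ ha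
    linarith
  · intro hk
    by_contra hkN
    have hki : (k : Fin n) ≠ i := fun e => hi (e ▸ k.2)
    have h3 : J k i = 0 := by
      by_contra hne
      exact hkN (by simp [neighbors, hki, hne])
    rw [hβ, h3] at h2
    simp only [zero_mul, neg_zero, sub_zero] at h2
    have h4 : η * a ≤ ν * a := mul_le_mul_of_nonneg_right hη₃ ha.le
    linarith

end Deterministic

/-! ### Chernoff bounds for Gaussian means and second moments. -/

section Tails

/-- This is half of $-\log(1-x)\le x+2x^2$. With $x=2tv$, the linear term cancels the centring of
$Z^2-v$ and leaves a sub-Gaussian bound for small $t$. -/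
lemma inv_sqrt_one_sub_le {x : ℝ} (hx : |x| ≤ 1 / 2) :
    (√(1 - x))⁻¹ ≤ Real.exp (x / 2 + x ^ 2) := by
  have hx1 : 0 < 1 - x := by linarith [(abs_le.mp hx).2]
  have h1 := Real.abs_log_sub_add_sum_range_le (lt_of_le_of_lt hx (by norm_num)) 1
  simp only [Finset.sum_range_one, zero_add, pow_one, Nat.cast_zero, div_one] at h1
  have h2 : |x| ^ (1 + 1) / (1 - |x|) ≤ 2 * x ^ 2 := by
    rw [div_le_iff₀ (by linarith), ← sq_abs x]
    have h3 := mul_nonneg (sq_nonneg |x|) (sub_nonneg.mpr hx)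
    have h4 : |x| ^ (1 + 1) = |x| ^ 2 := rfl
    rw [h4]
    linarith
  have h3 : -(x + 2 * x ^ 2) ≤ Real.log (1 - x) := by linarith [(abs_le.mp (h1.trans h2)).1]
  rw [← Real.exp_log (inv_pos.mpr (Real.sqrt_pos.mpr hx1)), Real.exp_le_exp, Real.log_inv,
    Real.log_sqrt hx1.le]
  linarith

/-- The moment generating function of the square of a centred Gaussian variable. -/
lemma mgf_sq_gaussianReal {v : NNReal} {t : ℝ} (ht : 2 * t * v < 1) :
    mgf (fun z => z ^ 2) (gaussianReal 0 v) t = (√(1 - 2 * t * v))⁻¹ := by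
  by_cases hv : v = 0
  · simp [hv, mgf]
  have hv0 : (0 : ℝ) < v := by positivity
  rw [mgf, integral_gaussianReal_eq_integral_smul hv]
  have h1 : ∀ x : ℝ, gaussianPDFReal 0 v x • Real.exp (t * x ^ 2) =
      (√(2 * Real.pi * v))⁻¹ * Real.exp (-((1 - 2 * t * v) / (2 * v)) * x ^ 2) := fun x => by
    rw [gaussianPDFReal, smul_eq_mul, mul_assoc, ← Real.exp_add]
    congr 2
    field_simp
    ring
  simp_rw [h1]
  rw [integral_const_mul, integral_gaussian, ← Real.sqrt_inv, ← Real.sqrt_inv,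
    ← Real.sqrt_mul (by positivity)]
  congr 1
  have h2 : 1 - 2 * t * (v : ℝ) ≠ 0 := by linarith
  field_simp

variable {Ω : Type*} {mΩ : MeasurableSpace Ω} {P : Measure Ω}

lemma mgf_sq_sub_le {Z : Ω → ℝ} {v : NNReal} (hZ : HasLaw Z (gaussianReal 0 v) P) {t V : ℝ}
    (hV : (v : ℝ) ≤ V) (ht : |t| * V ≤ 1 / 4) :
    0 < mgf (fun ω => Z ω ^ 2 + -v) P t ∧
      mgf (fun ω => Z ω ^ 2 + -v) P t ≤ Real.exp (4 * t ^ 2 * V ^ 2) := by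
  have hv := v.coe_nonneg
  have h0 : |2 * t * v| ≤ 1 / 2 := by
    rw [abs_mul, abs_mul, abs_of_nonneg hv, abs_of_pos (by norm_num : (0 : ℝ) < 2)]
    nlinarith [mul_le_mul_of_nonneg_left hV (abs_nonneg t)]
  have h1 : 2 * t * v < 1 := by linarith [(abs_le.mp h0).2]
  have h2 : mgf (fun ω => Z ω ^ 2) P t = (√(1 - 2 * t * v))⁻¹ := by
    rw [← mgf_sq_gaussianReal h1, ← hZ.map_eq, mgf_map hZ.aemeasurable (by fun_prop)]
    rfl
  rw [mgf_add_const, h2]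
  refine ⟨mul_pos (inv_pos.mpr (Real.sqrt_pos.mpr (by linarith))) (Real.exp_pos _), ?_⟩
  refine (mul_le_mul_of_nonneg_right (inv_sqrt_one_sub_le h0) (Real.exp_nonneg _)).trans ?_
  rw [← Real.exp_add, Real.exp_le_exp]
  have h3 : (v : ℝ) ^ 2 ≤ V ^ 2 := by gcongr
  nlinarith [sq_nonneg t, mul_le_mul_of_nonneg_left h3 (sq_nonneg t)]

variable [IsProbabilityMeasure P] {N : ℕ}

/-- Chernoff bound for the mean of independent variables. -/
lemma measureReal_le_sum_le_exp {Y : Fin N → Ω → ℝ} {t c ρ : ℝ} (hY : iIndepFun Y P)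
    (hm : ∀ k, AEMeasurable (Y k) P) (ht : 0 ≤ t) (hpos : ∀ k, 0 < mgf (Y k) P t)
    (hle : ∀ k, mgf (Y k) P t ≤ Real.exp c) :
    P.real {ω | N * ρ ≤ ∑ k, Y k ω} ≤ Real.exp (-(t * ρ - c) * N) := by
  have h1 : mgf (∑ k, Y k) P t = ∏ k, mgf (Y k) P t := hY.mgf_sum₀ hm _
  have h2 : 0 < mgf (∑ k, Y k) P t := by
    rw [h1]; exact Finset.prod_pos fun k _ => hpos k
  have h3 := measure_ge_le_exp_mul_mgf (N * ρ) ht (mgf_pos_iff.mp h2)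
  have h4 : mgf (∑ k, Y k) P t ≤ Real.exp (N * c) := by
    rw [h1, Real.exp_nat_mul]
    calc _ ≤ ∏ _k : Fin N, Real.exp c :=
          Finset.prod_le_prod (fun k _ => (hpos k).le) fun k _ => hle k
      _ = _ := by simp
  simp only [Finset.sum_apply] at h3
  refine h3.trans ((mul_le_mul_of_nonneg_left h4 (Real.exp_nonneg _)).trans (le_of_eq ?_))
  rw [← Real.exp_add]
  ring_nf

lemma measureReal_union_le_two_mul {A B C : Set Ω} {c : ℝ} (h : A ⊆ B ∪ C) (hB : P.real B ≤ c)
    (hC : P.real C ≤ c) : P.real A ≤ 2 * c := by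
  have := (measureReal_mono (μ := P) h).trans (measureReal_union_le B C)
  linarith

/-- The empirical second moment of independent centred Gaussian variables concentrates. -/
lemma measureReal_abs_secondMoment_sub_le {Z : Fin N → Ω → ℝ} {v : NNReal}
    (hind : iIndepFun Z P) (hZ : ∀ k, HasLaw (Z k) (gaussianReal 0 v) P) (hN : 0 < N) {V ρ : ℝ}
    (hV0 : 0 < V) (hV : (v : ℝ) ≤ V) (hρ : 0 ≤ ρ) (hρV : ρ ≤ 2 * V) :
    P.real {ω | ρ ≤ |(N : ℝ)⁻¹ * ∑ k, Z k ω ^ 2 - v|} ≤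
      2 * Real.exp (-(ρ ^ 2 / (16 * V ^ 2)) * N) := by
  have hN' : (0 : ℝ) < N := by exact_mod_cast hN
  have hm := fun k => (hZ k).aemeasurable
  -- The maximizer of $t\rho-4t^2V^2$; the restriction $tV\le1/4$ is the hypothesis $\rho\le2V$.
  set t := ρ / (8 * V ^ 2) with ht
  have ht0 : 0 ≤ t := by positivity
  have htV : |t| * V ≤ 1 / 4 := by
    rw [abs_of_nonneg ht0, ht]
    have : ρ / (8 * V ^ 2) * V = ρ / (8 * V) := by field_simp
    rw [this, div_le_iff₀ (by positivity)]
    linarith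
  have hexp : t * ρ - 4 * t ^ 2 * V ^ 2 = ρ ^ 2 / (16 * V ^ 2) := by
    rw [ht]; field_simp; ring
  have hsum : ∀ ω, ∑ k, (Z k ω ^ 2 + -(v : ℝ)) = N * ((N : ℝ)⁻¹ * ∑ k, Z k ω ^ 2 - v) := fun ω => by
    rw [Finset.sum_add_distrib]
    simp
    field_simp
    ring
  have hYm : ∀ k, AEMeasurable (fun ω => Z k ω ^ 2 + -(v : ℝ)) P := fun k =>
    ((hm k).pow_const 2).add_const _
  have hYi : iIndepFun (fun k ω => Z k ω ^ 2 + -(v : ℝ)) P :=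
    hind.comp (fun _ z => z ^ 2 + -(v : ℝ)) fun _ => by fun_prop
  have hYi' : iIndepFun (fun k => -fun ω => Z k ω ^ 2 + -(v : ℝ)) P :=
    hind.comp (fun _ z => -(z ^ 2 + -(v : ℝ))) fun _ => by fun_prop
  have h1 := measureReal_le_sum_le_exp (ρ := ρ) hYi hYm ht0
    (fun k => (mgf_sq_sub_le (hZ k) hV htV).1) fun k => (mgf_sq_sub_le (hZ k) hV htV).2
  have h2 := measureReal_le_sum_le_exp (ρ := ρ) (c := 4 * t ^ 2 * V ^ 2) hYi' (fun k => (hYm k).neg)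
    ht0 (fun k => by rw [mgf_neg]; exact (mgf_sq_sub_le (hZ k) hV (by rwa [abs_neg])).1)
    fun k => by
      rw [mgf_neg]
      have := (mgf_sq_sub_le (t := -t) (hZ k) hV (by rwa [abs_neg])).2
      rwa [neg_sq] at this
  rw [hexp] at h1 h2
  refine measureReal_union_le_two_mul (fun ω hω => ?_) h1 h2
  simp only [Set.mem_ofPred_eq, Set.mem_union, Pi.neg_apply, Finset.sum_neg_distrib, hsum,
    ← mul_neg] at hω ⊢
  rcases le_abs.mp hω with h | h
  · exact Or.inl (by gcongr)
  · exact Or.inr (by gcongr)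

/-- The empirical mean of independent centred Gaussian variables concentrates. -/
lemma measureReal_abs_mean_le {Z : Fin N → Ω → ℝ} {v : NNReal}
    (hind : iIndepFun Z P) (hZ : ∀ k, HasLaw (Z k) (gaussianReal 0 v) P) (hN : 0 < N) {V ρ : ℝ}
    (hV0 : 0 < V) (hV : (v : ℝ) ≤ V) (hρ : 0 ≤ ρ) :
    P.real {ω | ρ ≤ |(N : ℝ)⁻¹ * ∑ k, Z k ω|} ≤
      2 * Real.exp (-(ρ ^ 2 / (2 * V)) * N) := by
  have hN' : (0 : ℝ) < N := by exact_mod_cast hN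
  have hm := fun k => (hZ k).aemeasurable
  set t := ρ / V with ht
  have ht0 : 0 ≤ t := by positivity
  have hexp : t * ρ - V * t ^ 2 / 2 = ρ ^ 2 / (2 * V) := by
    rw [ht]; field_simp; ring
  have hmgf : ∀ (s : ℝ) k, mgf (Z k) P s = Real.exp (v * s ^ 2 / 2) := fun s k => by
    rw [mgf_gaussianReal (hZ k).map_eq]; simp
  have hle : ∀ s : ℝ, Real.exp (v * s ^ 2 / 2) ≤ Real.exp (V * s ^ 2 / 2) := fun s => by
    gcongr
  have hind' : iIndepFun (fun k => -Z k) P := hind.comp (fun _ z => -z) fun _ => by fun_prop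
  have h1 := measureReal_le_sum_le_exp (ρ := ρ) (c := V * t ^ 2 / 2) hind hm ht0
    (fun k => by rw [hmgf]; exact Real.exp_pos _) fun k => by rw [hmgf]; exact hle t
  have h2 := measureReal_le_sum_le_exp (ρ := ρ) (c := V * t ^ 2 / 2) hind' (fun k => (hm k).neg) ht0
    (fun k => by rw [mgf_neg, hmgf]; exact Real.exp_pos _)
    fun k => by rw [mgf_neg, hmgf, ← neg_sq t]; exact hle (-t)
  rw [hexp] at h1 h2
  refine measureReal_union_le_two_mul (fun ω hω => ?_) h1 h2
  have hsum : ∑ k, Z k ω = N * ((N : ℝ)⁻¹ * ∑ k, Z k ω) := by field_simp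
  simp only [Set.mem_ofPred_eq, Set.mem_union, Pi.neg_apply, Finset.sum_neg_distrib] at hω ⊢
  rw [hsum, ← mul_neg]
  rcases le_abs.mp hω with h | h
  · exact Or.inl (by gcongr)
  · exact Or.inr (by gcongr)

end Tails

/-! ### Entrywise concentration of the empirical covariance. -/

section Samples

variable {n N : ℕ} {m : EuclideanSpace ℝ (Fin n)} {S : Matrix (Fin n) (Fin n) ℝ}
  {Ω : Type*} {mΩ : MeasurableSpace Ω} {P : Measure Ω} [IsProbabilityMeasure P]
  {X : Fin N → Ω → EuclideanSpace ℝ (Fin n)}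

lemma hasLaw_inner_multivariateGaussian (hS : S.PosSemidef) (u : EuclideanSpace ℝ (Fin n)) :
    HasLaw (fun x => inner ℝ u x - inner ℝ u m)
      (gaussianReal 0 (u ⬝ᵥ S.mulVec u).toNNReal) (multivariateGaussian m S) := by
  have h1 : HasLaw (fun x => inner ℝ u x) (gaussianReal (inner ℝ u m)
      (u ⬝ᵥ S.mulVec u).toNNReal) (multivariateGaussian m S) := by
    refine ⟨by fun_prop, ?_⟩
    have h2 := IsGaussian.map_eq_gaussianReal (μ := multivariateGaussian m S) (innerSL ℝ u)
    have h3 : Var[innerSL ℝ u; multivariateGaussian m S] = u ⬝ᵥ S.mulVec u := by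
      rw [← covarianceBilin_multivariateGaussian (μ := m) hS,
        covarianceBilin_self IsGaussian.memLp_two_id]
      rfl
    rw [h3, ContinuousLinearMap.integral_comp_id_comm IsGaussian.integrable_id,
      integral_id_multivariateGaussian] at h2
    exact h2
  simpa using gaussianReal_sub_const h1 (inner ℝ u m)

/-- The entries of the empirical covariance and of the squared sample mean error are off by `θ` with
small probability. -/
lemma measureReal_exists_lt_abs_le (hS : S.PosSemidef) {B θ : ℝ} (hB : 0 ≤ B)
    (hSB : ∀ k l, |S k l| ≤ B) (hθ : 0 ≤ θ) (hθ1 : θ ≤ 1) (hN : 0 < N) (hX : iIndepFun X P)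
    (hlaw : ∀ t, HasLaw (X t) (multivariateGaussian m S) P) :
    P.real {ω | ∃ k l, θ < |empCov m (fun t => X t ω) k l - S k l| ∨
      θ < (sampleMean (fun t => X t ω) k - m k) ^ 2} ≤
      (n : ℝ) ^ 2 * (6 * Real.exp (-(θ ^ 2 / (64 * (B + 1) ^ 2)) * N)) := by
  have hN' : (0 : ℝ) < N := by exact_mod_cast hN
  set p := Real.exp (-(θ ^ 2 / (64 * (B + 1) ^ 2)) * N) with hp
  let e : Fin n → EuclideanSpace ℝ (Fin n) := fun k => EuclideanSpace.single k 1
  have hSs : ∀ k l, S l k = S k l := fun k l => by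
    have := hS.isHermitian.apply k l
    simpa using this
  have hZ : ∀ u t, HasLaw (fun ω => inner ℝ u (X t ω) - inner ℝ u m)
      (gaussianReal 0 (u ⬝ᵥ S.mulVec u).toNNReal) P := fun u t =>
    (hasLaw_inner_multivariateGaussian hS u).comp (hlaw t)
  have hZi : ∀ u, iIndepFun (fun t ω => inner ℝ u (X t ω) - inner ℝ u m) P := fun u =>
    hX.comp (fun _ x => inner ℝ u x - inner ℝ u m) fun _ => by fun_prop
  have hnn : ∀ u : EuclideanSpace ℝ (Fin n), ((u ⬝ᵥ S.mulVec u).toNNReal : ℝ) =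
      u ⬝ᵥ S.mulVec u := fun u => by
    apply Real.coe_toNNReal
    simpa using hS.dotProduct_mulVec_nonneg u
  have hsq : ∀ u : EuclideanSpace ℝ (Fin n), u ⬝ᵥ S.mulVec u ≤ 4 * (B + 1) →
      P.real {ω | 2 * θ ≤ |(N : ℝ)⁻¹ * ∑ t, (inner ℝ u (X t ω) - inner ℝ u m) ^ 2 -
        u ⬝ᵥ S.mulVec u|} ≤ 2 * p := fun u hu => by
    -- The directions $e_k\pm e_l$ have variance at most $4B$. Using $B+1$ keeps `V` positive and
    -- makes $2\theta\le2V$ follow from $\theta\le1$.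
    have := measureReal_abs_secondMoment_sub_le (hZi u) (hZ u) hN (V := 4 * (B + 1)) (ρ := 2 * θ)
      (by positivity) (by rwa [hnn]) (by positivity) (by linarith)
    rw [hnn] at this
    refine this.trans (le_of_eq ?_)
    rw [hp]
    congr 4
    field_simp
    ring
  have hmean : ∀ k, P.real {ω | √θ ≤ |(N : ℝ)⁻¹ * ∑ t, (inner ℝ (e k) (X t ω) -
      inner ℝ (e k) m)|} ≤ 2 * p := fun k => by
    have hv : (e k) ⬝ᵥ S.mulVec (e k) = S k k := by simp [e]
    have := measureReal_abs_mean_le (hZi (e k)) (hZ (e k)) hN (V := B + 1) (ρ := √θ)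
      (by positivity) (by rw [hnn, hv]; linarith [le_abs_self (S k k), hSB k k])
      (Real.sqrt_nonneg _)
    refine this.trans ?_
    rw [hp, Real.sq_sqrt hθ]
    have h1 : θ ^ 2 / (64 * (B + 1) ^ 2) ≤ θ / (2 * (B + 1)) := by
      apply div_le_div₀ hθ (by nlinarith) (by positivity)
      nlinarith
    have h2 := mul_le_mul_of_nonneg_right (neg_le_neg h1) hN'.le
    linarith [Real.exp_le_exp.mpr h2]
  have hpair : ∀ k l, P.real {ω | θ < |empCov m (fun t => X t ω) k l - S k l| ∨
      θ < (sampleMean (fun t => X t ω) k - m k) ^ 2} ≤ 6 * p := by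
    intro k l
    have e1 : (e k + e l).ofLp ⬝ᵥ S.mulVec (e k + e l).ofLp = S k k + S l l + 2 * S k l := by
      simp [e, Matrix.mulVec_add, add_dotProduct, dotProduct_add, hSs k l]
      ring
    have e2 : (e k - e l).ofLp ⬝ᵥ S.mulVec (e k - e l).ofLp = S k k + S l l - 2 * S k l := by
      simp [e, Matrix.mulVec_sub, sub_dotProduct, dotProduct_sub, hSs k l]
      ring
    have b1 := abs_le.mp (hSB k k)
    have b2 := abs_le.mp (hSB l l)
    have b3 := abs_le.mp (hSB k l)
    have p1 := hsq (e k + e l) (by rw [e1]; linarith)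
    have p2 := hsq (e k - e l) (by rw [e2]; linarith)
    have p3 := hmean k
    rw [e1] at p1
    rw [e2] at p2
    refine (measureReal_mono ?_).trans ((measureReal_union_le _ _).trans
      ((add_le_add p1 ((measureReal_union_le _ _).trans (add_le_add p2 p3))).trans
      (le_of_eq (by ring))))
    intro ω hω
    simp only [Set.mem_union, Set.mem_ofPred_eq] at hω ⊢
    by_contra! hcon
    obtain ⟨c1, c2, c3⟩ := hcon
    have f1 : ∀ t, inner ℝ (e k + e l) (X t ω) - inner ℝ (e k + e l) m =
        (X t ω k - m k) + (X t ω l - m l) := fun t => by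
      simp [e, inner_add_left, EuclideanSpace.inner_single_left]; ring
    have f2 : ∀ t, inner ℝ (e k - e l) (X t ω) - inner ℝ (e k - e l) m =
        (X t ω k - m k) - (X t ω l - m l) := fun t => by
      simp [e, inner_sub_left, EuclideanSpace.inner_single_left]; ring
    simp only [f1] at c1
    simp only [f2] at c2
    rcases hω with h | h
    · refine absurd h (not_lt.mpr ?_)
      -- Polarization: two errors below $2\theta$ give an error below $4\theta$ in four times the
      -- entry.
      have h4 : 4 * empCov m (fun t => X t ω) k l =
          (N : ℝ)⁻¹ * ∑ t, ((X t ω k - m k) + (X t ω l - m l)) ^ 2 -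
          (N : ℝ)⁻¹ * ∑ t, ((X t ω k - m k) - (X t ω l - m l)) ^ 2 := by
        rw [empCov, Matrix.of_apply, ← mul_sub, ← Finset.sum_sub_distrib, mul_left_comm,
          Finset.mul_sum]
        congr 1
        exact Finset.sum_congr rfl fun t _ => by ring
      have c1' := abs_lt.mp c1
      have c2' := abs_lt.mp c2
      rw [abs_le]
      constructor <;> linarith
    · refine absurd h (not_lt.mpr ?_)
      have h5 : sampleMean (fun t => X t ω) k - m k =
          (N : ℝ)⁻¹ * ∑ t, (inner ℝ (e k) (X t ω) - inner ℝ (e k) m) := by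
        simp [e, sampleMean, Finset.sum_sub_distrib, EuclideanSpace.inner_single_left]
        field_simp
      rw [h5, ← sq_abs, ← Real.sq_sqrt hθ]
      gcongr
  have hunion : {ω | ∃ k l, θ < |empCov m (fun t => X t ω) k l - S k l| ∨
      θ < (sampleMean (fun t => X t ω) k - m k) ^ 2} =
      ⋃ q : Fin n × Fin n, {ω | θ < |empCov m (fun t => X t ω) q.1 q.2 - S q.1 q.2| ∨
      θ < (sampleMean (fun t => X t ω) q.1 - m q.1) ^ 2} := by
    ext ω
    simp
  rw [hunion]
  refine (measureReal_iUnion_fintype_le _).trans ((Finset.sum_le_sum fun q _ =>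
    hpair q.1 q.2).trans (le_of_eq ?_))
  simp [sq]

/-- Replacing the true mean by the sample mean costs only a rank-one term, quadratic in the mean
error. Hence the mean needs accuracy only $\sqrt\theta$. -/
lemma empCov_sampleMean (hN : 0 < N) (m : EuclideanSpace ℝ (Fin n))
    (x : Fin N → EuclideanSpace ℝ (Fin n)) (k l : Fin n) :
    empCov (sampleMean x) x k l =
      empCov m x k l - (sampleMean x k - m k) * (sampleMean x l - m l) := by
  have hN' : (N : ℝ) ≠ 0 := by positivity
  have hs : ∀ j, ∑ t, (x t j - m j) = N * (sampleMean x j - m j) := fun j => by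
    simp [sampleMean, Finset.sum_sub_distrib, mul_sub, hN']
  simp only [empCov, Matrix.of_apply]
  have h1 : ∀ t, (x t k - sampleMean x k) * (x t l - sampleMean x l) =
      (x t k - m k) * (x t l - m l) - (sampleMean x l - m l) * (x t k - m k) -
      (sampleMean x k - m k) * (x t l - m l) +
      (sampleMean x k - m k) * (sampleMean x l - m l) := fun t => by ring
  simp_rw [h1, Finset.sum_add_distrib, Finset.sum_sub_distrib, ← Finset.mul_sum, hs]
  simp
  field_simp
  ring

end Samples

/-! ### Choice of constants and assembly. -/

lemma one_sub_le_measureReal_of_compl_subset {Ω : Type*} {mΩ : MeasurableSpace Ω} {P : Measure Ω}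
    [IsProbabilityMeasure P] {A B : Set Ω} {c : ℝ} (h : Bᶜ ⊆ A) (hB : P.real B ≤ c) :
    1 - c ≤ P.real A := by
  have h1 : P.real (Set.univ : Set Ω) ≤ P.real (A ∪ B) := measureReal_mono fun ω _ => by
    by_cases hω : ω ∈ B
    · exact Or.inr hω
    · exact Or.inl (h hω)
  have h2 := h1.trans (measureReal_union_le A B)
  rw [probReal_univ] at h2
  linarith

lemma sq_mul_exp_le {n : ℕ} (hn : 0 < n) {c x : ℝ} (hx : 4 * Real.log n ≤ c * x) :
    (n : ℝ) ^ 2 * Real.exp (-c * x) ≤ Real.exp (-(c / 2) * x) := by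
  have hn' : (0 : ℝ) < n := by exact_mod_cast hn
  have h1 : (n : ℝ) ^ 2 = Real.exp (2 * Real.log n) := by
    rw [show 2 * Real.log n = Real.log n + Real.log n by ring, Real.exp_add, Real.exp_log hn', sq]
  rw [h1, ← Real.exp_add, Real.exp_le_exp]
  linarith

/-- An entrywise accuracy `η * a`, with `η` independent of `a`, for which the algorithm is correct.
-/
lemma exists_accuracy {α dmin dmax κ δ ν : ℝ} {Δ : ℕ} (hα : 0 < α) (hα1 : α < 1)
    (hdmin : 0 < dmin) (hd : dmin ≤ dmax) (hδ : 0 < δ) (hν : 0 < ν) (hνd : ν * dmax < 1) :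
    ∃ η > (0 : ℝ), ∀ a b ε : ℝ, 0 < a → b ≤ κ * a →
      δ * a ≤ baseThreshold α dmax a - ε →
      baseThreshold α dmax a - ε ≤ (1 - δ) * (a / (dmax ^ 2 * (1 + α) - a ^ 2)) →
      0 < dmax ^ 2 * (1 + α) - a ^ 2 → η * a ≤ 1 ∧
      ∀ (n : ℕ) (J C : Matrix (Fin n) (Fin n) ℝ) (i : Fin n), ModelAssumption α dmin dmax a b Δ J →
        (∀ k l, |C k l - J⁻¹ k l| ≤ 2 * (η * a)) →
        IsExact J i (learnNeighborhood C i Δ α dmax a ε ν) := by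
  have hdm : 0 < dmax := hdmin.trans_le hd
  have hl : 0 < (1 - α) * dmin := mul_pos (by linarith) hdmin
  have hL : 0 < (1 + α) * dmax := by positivity
  obtain ⟨M, hM⟩ := exists_nat_ge (Δ * κ ^ 2 / (((1 - α) * dmin) ^ 4 * (δ / 2) ^ 2))
  rw [div_le_iff₀ (by positivity)] at hM
  set μ := ((1 + α) * dmax)⁻¹ with hμ
  set B := ((1 - α) * dmin)⁻¹ with hB
  have hμ0 : 0 < μ := inv_pos.mpr hL
  have hB0 : 0 < B := inv_pos.mpr hl
  set K := condErr μ B (Δ * M)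
  have hK : 0 < K := by
    have h1 := coeffErr_nonneg hμ0 hB0.le (Δ * M)
    simp only [K, condErr]
    positivity
  have hνd' : 0 < dmax⁻¹ - ν := by
    rw [sub_pos, lt_inv_comm₀ hν hdm, ← one_div, lt_div_iff₀ hν]
    linarith
  -- `ζ * a` is the tolerance for conditional covariances and coefficients; the last entry is halved
  -- because that margin must be strict.
  set ζ := min (min (δ / 2) (δ / (2 * dmax ^ 2))) (min ν ((dmax⁻¹ - ν) / 2)) with hζ
  have hζ0 : 0 < ζ := by
    simp only [hζ, lt_min_iff]
    exact ⟨⟨by positivity, by positivity⟩, hν, by positivity⟩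
  set s : ℝ := ((Δ * M : ℕ) : ℝ)
  have hs : 0 ≤ s := Nat.cast_nonneg _
  -- With $a\le2d_{\max}$ and $\theta=2\eta a$, the three entries give in turn $\theta\le1$,
  -- $s\theta\le\mu/2$ and $K\theta\le\zeta a$.
  set η := min (min (1 / (4 * dmax)) (μ / (8 * dmax * (s + 1)))) (ζ / (2 * K)) with hη
  have hη0 : 0 < η := by
    simp only [hη, lt_min_iff]
    exact ⟨⟨by positivity, by positivity⟩, by positivity⟩
  have hη1 : η * (4 * dmax) ≤ 1 := by
    rw [← le_div_iff₀ (by positivity)]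
    exact (min_le_left _ _).trans (min_le_left _ _)
  have hη2 : η * (8 * dmax * (s + 1)) ≤ μ := by
    rw [← le_div_iff₀ (by positivity)]
    exact (min_le_left _ _).trans (min_le_right _ _)
  have hη3 : η * (2 * K) ≤ ζ := by
    rw [← le_div_iff₀ (by positivity)]
    exact min_le_right _ _
  refine ⟨η, hη0, fun a b ε ha hb hτ hτ' had => ?_⟩
  have had' : a ≤ 2 * dmax := by
    apply le_of_sq_le_sq _ (by positivity)
    nlinarith [sq_nonneg dmax]
  have hηa : η * a ≤ η * (2 * dmax) := mul_le_mul_of_nonneg_left had' hη0.le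
  refine ⟨by linarith [mul_pos hη0 hdm], fun n J C i h hC => ?_⟩
  refine isExact_learnNeighborhood hα hα1 hdmin hδ ha hb hτ hτ' had (by linarith) (M := M) (η := ζ)
    ((min_le_left _ _).trans (min_le_left _ _)) ((min_le_left _ _).trans (min_le_right _ _))
    ((min_le_right _ _).trans (min_le_left _ _))
    (((min_le_right _ _).trans (min_le_right _ _)).trans_lt (half_lt_self hνd'))
    h i (by positivity) (by linarith) ?_ ?_ hC
  · have h1 : s * (2 * (η * a)) ≤ s * (2 * (η * (2 * dmax))) := by gcongr
    have h2 : 0 ≤ η * dmax := by positivity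
    change s * _ ≤ μ / 2
    linarith
  · change K * _ ≤ _
    calc K * (2 * (η * a)) = η * (2 * K) * a := by ring
      _ ≤ ζ * a := by gcongr

end GGM

end

theorem mainTheorem1 (α dmin dmax κ δ ν : ℝ) (Δ : ℕ) (hα : 0 < α) (hα1 : α < 1)
    (hdmin : 0 < dmin) (hδ : 0 < δ) (hδ1 : δ < 1) (hν : 0 < ν) (hνd : ν * dmax < 1) :
    ∃ C₃ > (0 : ℝ), ∃ C₄ > (0 : ℝ), ∀ a b ε : ℝ, 0 < a → b ≤ κ * a →
      δ * a ≤ GGM.baseThreshold α dmax a - ε →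
      GGM.baseThreshold α dmax a - ε ≤ (1 - δ) * (a / (dmax ^ 2 * (1 + α) - a ^ 2)) →
      ∃ C₅ > (0 : ℝ), ∀ (n N : ℕ) (J : Matrix (Fin n) (Fin n) ℝ)
        (m : EuclideanSpace ℝ (Fin n)) (i : Fin n)
        (Ω : Type*) (_ : MeasurableSpace Ω) (P : Measure Ω) (_ : IsProbabilityMeasure P)
        (X : Fin N → Ω → EuclideanSpace ℝ (Fin n)),
        GGM.ModelAssumption α dmin dmax a b Δ J →
        iIndepFun X P →
        (∀ t, HasLaw (X t) (multivariateGaussian m J⁻¹) P) →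
        (N : ℝ) > C₃ * (a ^ 2)⁻¹ * Real.log n →
        1 - C₄ * Real.exp (-C₅ * N) ≤ P.real {ω | GGM.IsExact J i
          (GGM.learnNeighborhood (GGM.empCov m (fun t => X t ω)) i Δ α dmax a ε ν)} ∧
        1 - C₄ * Real.exp (-C₅ * N) ≤ P.real {ω | GGM.IsExact J i
          (GGM.learnNeighborhood
            (GGM.empCov (GGM.sampleMean (fun t => X t ω)) (fun t => X t ω)) i Δ α dmax a ε ν)} := by
  by_cases hd : dmin ≤ dmax
  swap
  · refine ⟨1, one_pos, 1, one_pos, fun a b ε _ _ _ _ => ⟨1, one_pos, ?_⟩⟩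
    intro n N J m i Ω _ P _ X h
    exact absurd ((h.diag_mem i).1.trans (h.diag_mem i).2) hd
  obtain ⟨η, hη, hacc⟩ := GGM.exists_accuracy (κ := κ) (Δ := Δ) hα hα1 hdmin hd hδ hν hνd
  have hl : 0 < (1 - α) * dmin := mul_pos (by linarith) hdmin
  set B := ((1 - α) * dmin)⁻¹ with hB
  have hB0 : 0 < B := inv_pos.mpr hl
  set c := η ^ 2 / (64 * (B + 1) ^ 2) with hc
  have hc0 : 0 < c := by positivity
  refine ⟨4 / c, by positivity, 6, by norm_num, fun a b ε ha hb hτ hτ' => ?_⟩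
  -- Otherwise the upper bound on the threshold would be nonpositive, while the lower bound is
  -- $\delta a>0$.
  have had : 0 < dmax ^ 2 * (1 + α) - a ^ 2 := by
    by_contra! hneg
    have h1 := mul_nonpos_of_nonneg_of_nonpos (sub_nonneg.mpr hδ1.le)
      (div_nonpos_of_nonneg_of_nonpos ha.le hneg)
    linarith [mul_pos hδ ha]
  obtain ⟨hηa, hexact⟩ := hacc a b ε ha hb hτ hτ' had
  refine ⟨c * a ^ 2 / 2, by positivity, ?_⟩
  intro n N J m i Ω _ P _ X h hX hlaw hN
  have hn : 0 < n := i.pos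
  have hlog : 0 ≤ Real.log n := Real.log_natCast_nonneg n
  have hN0 : 0 < N := by
    have : (0 : ℝ) < N := lt_of_le_of_lt (by positivity) hN
    exact_mod_cast this
  have hJC := Matrix.mul_nonsing_inv J (isUnit_iff_ne_zero.mpr h.posDef.det_pos.ne')
  have hent := GGM.abs_apply_le_inv_of_mul_eq_one hl hJC (h.coercive hdmin hα1)
  have hbad := GGM.measureReal_exists_lt_abs_le h.posDef.inv.posSemidef hB0.le hent
    (mul_pos hη ha).le hηa hN0 hX hlaw
  have hprob : (n : ℝ) ^ 2 * (6 * Real.exp (-((η * a) ^ 2 / (64 * (B + 1) ^ 2)) * N)) ≤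
      6 * Real.exp (-(c * a ^ 2 / 2) * N) := by
    have h1 : (η * a) ^ 2 / (64 * (B + 1) ^ 2) = c * a ^ 2 := by rw [hc]; ring
    have h2 : 4 * Real.log n ≤ c * a ^ 2 * N := by
      have h3 := mul_le_mul_of_nonneg_left hN.le (by positivity : 0 ≤ c * a ^ 2)
      have h4 : c * a ^ 2 * (4 / c * (a ^ 2)⁻¹ * Real.log n) = 4 * Real.log n := by field_simp
      linarith
    rw [h1, mul_left_comm]
    exact mul_le_mul_of_nonneg_left (GGM.sq_mul_exp_le hn h2) (by norm_num)
  refine ⟨GGM.one_sub_le_measureReal_of_compl_subset (fun ω hω => ?_) (hbad.trans hprob),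
    GGM.one_sub_le_measureReal_of_compl_subset (fun ω hω => ?_) (hbad.trans hprob)⟩ <;>
  simp only [Set.mem_compl_iff, Set.mem_ofPred_eq, not_exists, not_or, not_lt] at hω ⊢
  · refine hexact n J _ i h fun k l => (hω k l).1.trans ?_
    linarith [mul_pos hη ha]
  · refine hexact n J _ i h fun k l => ?_
    rw [GGM.empCov_sampleMean hN0 m]
    have h1 := abs_le.mp (hω k l).1
    have h2 := (hω k l).2
    have h3 := (hω l k).2
    set x := GGM.sampleMean (fun t => X t ω) k - m k
    set y := GGM.sampleMean (fun t => X t ω) l - m l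
    rw [abs_le]
    -- $|xy|\le(x^2+y^2)/2\le\eta a$ is added to the error with known mean, which explains the
    -- tolerance $2\eta a$.
    constructor <;> nlinarith [sq_nonneg (x + y), sq_nonneg (x - y)]
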